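/- A \emph{Heyting category} is a regular category $\mathcal E$ (finite limits, coequalizers of kernel pairs, regular epimorphisms stable under pullback) in which every poset of subobjects $\mathrm{Sub}(X)$ is a Heyting algebra and in which, for every $f:X\to Y$, the inverse image map $f^{-1}:\mathrm{Sub}(Y)\to\mathrm{Sub}(X)$ has both a left adjoint $\exists_f$ and a right adjoint $\forall_f$. It is \emph{locally Cartesian closed} if all its slice categories $\mathcal E/X$ are Cartesian closed. The definitions below are read in the internal language of $\mathcal E$; a subobject is \emph{inhabited} if its unique arrow to the terminal object is a regular epimorphism, and two subobjects \emph{intersect} if their intersection is inhabited. An \emph{ordered partial applicative structure} (OPAS) in $\mathcal E$ is an object $A$ with a partial order $\leq$ and a partial application $(x,y)\mapsto xy$ such that $a\leq b$, $c\leq d$ and $bd\downarrow e$ imply $ac\downarrow f$ for some $f\leq e$; here $xy\downarrow z$ means that $xy$ is defined and equal to $z$. The \emph{partial combinatory arrows} $A^n\rightharpoonup A$ are the members of the least set of partial arrows that contains the projections and is closed under pointwise application. An element $a$ of $A$ \emph{represents} $f:A^n\rightharpoonup A$ if for all $\vec x\in A^n$ the iterated applications $(\cdots(ax_1)\cdots)x_i$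 with $i<n$ are defined and, whenever $\vec x\in\mathrm{dom} f$, there is a $y\leq f(\vec x)$ with $(\cdots(ax_1)\cdots)x_n\downarrow y$. Let $[\![f]\!]\leq A$ be the subobject of the elements that represent $f$. An \emph{OPCA pair} $(A',A)$ consists of an OPAS $A$ and a subobject $A'\leq A$, with the restricted structure, such that $x,y\in A'$ and $xy\downarrow z$ imply $z\in A'$, and such that $[\![f]\!]$ intersects $A'$ for every partial combinatory arrow $f$ of $A$. An \emph{assembly} for $(A',A)$ is a pair $(X,Y)$ of an object $X$ of $\mathcal E$ and a subobject $Y\leq A\times X$ such that for all $x\in X$ there is an $a\in A$ with $(a,x)\in Y$, and such that $(a,x)\in Y$ and $b\leq a$ imply $(b,x)\in Y$. A \emph{morphism} $(X,Y)\to(X',Y')$ is an arrow $f:X\to X'$ of $\mathcal E$ for which there is a subobject $V\leq A$ that intersects $A'$ and such that for all $a\in V$ and $(b,x)\in Y$ the application $ab$ is defined and $(ab,f(x))\in Y'$. Assemblies and their morphisms, with the identities and the composition of $\mathcal E$, form a category $\mathrm{Asm}(A',A)$. \textbf{Theorem.} For every locally Cartesian closed Heyting category $\mathcal E$ and every OPCA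 pair $(A',A)$ in $\mathcal E$, the category $\mathrm{Asm}(A',A)$ is a locally Cartesian closed Heyting category. -/

import Mathlib

open CategoryTheory Limits

universe v u

/-! ### Heyting categories and local cartesian closure -/

/-- A Heyting category: a regular category in which every poset of subobjects is a Heyting algebra
and every inverse image map has both a left adjoint (image) and a right adjoint (`∀`). -/
class HeytingCategory (C : Type u) [Category.{v} C] : Prop extends Regular C where
  heyting (X : C) : ∃ H : HeytingAlgebra (Subobject X), ∀ U V : Subobject X, H.le U V ↔ U ≤ V
  exists_im {X Y : C} (f : X ⟶ Y) :
    ∃ im : Subobject X → Subobject Y, GaloisConnection im (Subobject.pullback f).obj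
  exists_all {X Y : C} (f : X ⟶ Y) :
    ∃ all : Subobject X → Subobject Y, GaloisConnection (Subobject.pullback f).obj all

/-- A category with pullbacks all of whose slices are cartesian closed. The cartesian structure on
the slice `Over X` is the one given by pullbacks over `X`. -/
class LocallyCartesianClosed (C : Type u) [Category.{v} C] : Prop where
  hasPullbacks : HasPullbacks C
  closed (X : C) :
    letI := Over.cartesianMonoidalCategory X
    Nonempty (MonoidalClosed (Over X))

/-! ### Generalized elements

The internal language is interpreted through generalized elements: an element of `X` at stage `T` is
a morphism `x : T ⟶ X`, it belongs to `U : Subobject X` when `U.Factors x`, and a sequent holds when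
it holds for all elements at all stages. Inhabitedness is expressed by regular epimorphisms. -/

section Elements

variable {C : Type u} [Category.{v} C]

/-- A partial arrow `X ⇀ Y`: an arrow to `Y` that is defined on a subobject of `X`. -/
structure PartialArrow (X Y : C) where
  dom : Subobject X
  map : (dom : C) ⟶ Y

namespace PartialArrow

/-- `f.Val x y` says that `x` is in the domain of `f` and that `f(x) = y`. -/
def Val {X Y : C} (f : PartialArrow X Y) {T : C} (x : T ⟶ X) (y : T ⟶ Y) : Prop :=
  ∃ h : f.dom.Factors x, f.dom.factorThru x h ≫ f.map = y

/-- A total arrow as a partial arrow. -/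
noncomputable def ofHom {X Y : C} (f : X ⟶ Y) : PartialArrow X Y where
  dom := ⊤
  map := (⊤ : Subobject X).arrow ≫ f

variable [HasFiniteLimits C]

/-- The partial arrow `x ↦ (f(x), g(x))`, defined where both `f` and `g` are. -/
noncomputable def pair {X Y Z : C} (f : PartialArrow X Y) (g : PartialArrow X Z) :
    PartialArrow X (Y ⨯ Z) where
  dom := f.dom ⊓ g.dom
  map := prod.lift (Subobject.ofLE _ _ inf_le_left ≫ f.map)
    (Subobject.ofLE _ _ inf_le_right ≫ g.map)

/-- The partial arrow `x ↦ g(f(x))`, defined where `f` is defined with value in the domain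
of `g`. -/
noncomputable def comp {X Y Z : C} (f : PartialArrow X Y) (g : PartialArrow Y Z) :
    PartialArrow X Z where
  dom := Subobject.mk (((Subobject.pullback f.map).obj g.dom).arrow ≫ f.dom.arrow)
  map := (Subobject.underlyingIso _).hom ≫ Subobject.pullbackπ f.map g.dom ≫ g.map

end PartialArrow

/-- Two subobjects intersect if their intersection is inhabited, i.e. if it covers the terminal
object. -/
def Intersects [HasFiniteLimits C] {X : C} (U V : Subobject X) : Prop :=
  IsRegularEpi (terminal.from ((U ⊓ V : Subobject X) : C))

end Elements

/-! ### Ordered partial applicative structures -/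

/-- An ordered partial applicative structure: an object with an internal partial order and a
monotone partial binary operator with downward closed domain. -/
structure OPAS (C : Type u) [Category.{v} C] [HasFiniteLimits C] where
  /-- the underlying object -/
  carrier : C
  /-- the ordering, as a relation -/
  le : Subobject (carrier ⨯ carrier)
  /-- the application operator -/
  app : PartialArrow (carrier ⨯ carrier) carrier
  le_refl {T : C} (a : T ⟶ carrier) : le.Factors (prod.lift a a)
  le_trans {T : C} (a b c : T ⟶ carrier) :
    le.Factors (prod.lift a b) → le.Factors (prod.lift b c) → le.Factors (prod.lift a c)
  le_antisymm {T : C} (a b : T ⟶ carrier) :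
    le.Factors (prod.lift a b) → le.Factors (prod.lift b a) → a = b
  app_mono {T : C} (a b c d e : T ⟶ carrier) :
    le.Factors (prod.lift a b) → le.Factors (prod.lift c d) → app.Val (prod.lift b d) e →
      ∃ f : T ⟶ carrier, app.Val (prod.lift a c) f ∧ le.Factors (prod.lift f e)

namespace OPAS

variable {C : Type u} [Category.{v} C]

section FiniteLimits

variable [HasFiniteLimits C] (A : OPAS C)

/-- `a ≤ b`, for elements at stage `T`. -/
def Le {T : C} (a b : T ⟶ A.carrier) : Prop := A.le.Factors (prod.lift a b)

/-- `ab ↓ c`: the application of `a` to `b` is defined and equal to `c`. -/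
def App {T : C} (a b c : T ⟶ A.carrier) : Prop := A.app.Val (prod.lift a b) c

/-- `((a x₁) x₂ ⋯) xₙ ↓ y`, where `x₁, …, xₙ` are the members of a list. -/
def AppList {T : C} : (T ⟶ A.carrier) → List (T ⟶ A.carrier) → (T ⟶ A.carrier) → Prop
  | a, [], y => a = y
  | a, x :: xs, y => ∃ b : T ⟶ A.carrier, A.App a x b ∧ AppList b xs y

/-- The power `A ^ n`. -/
noncomputable abbrev pow (n : ℕ) : C := ∏ᶜ fun _ : Fin n => A.carrier

/-- The list of coordinates of an element of `A ^ n`. -/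
noncomputable def coords {n : ℕ} {T : C} (x : T ⟶ A.pow n) : List (T ⟶ A.carrier) :=
  List.ofFn fun i : Fin n => x ≫ Pi.π (fun _ : Fin n => A.carrier) i

/-- Pointwise application `x ↦ f(x)g(x)` of partial arrows. -/
noncomputable def mul {X : C} (f g : PartialArrow X A.carrier) : PartialArrow X A.carrier :=
  (f.pair g).comp A.app

/-- The partial combinatory arrows `A ^ n ⇀ A`: the least set of partial arrows that contains the
projections and is closed under pointwise application. -/
inductive IsCombinatory (n : ℕ) : PartialArrow (A.pow n) A.carrier → Prop
  | proj (i : Fin n) :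
      IsCombinatory n (PartialArrow.ofHom (Pi.π (fun _ : Fin n => A.carrier) i))
  | mul (f g : PartialArrow (A.pow n) A.carrier) :
      IsCombinatory n f → IsCombinatory n g → IsCombinatory n (A.mul f g)

/-- The element `a` at stage `T` represents the partial arrow `f : A ^ n ⇀ A`: for every
`x` in `A ^ n` the applications `a x₁ ⋯ xᵢ` with fewer than `n` arguments are defined, and if `x` is
in the domain of `f` then `a x₁ ⋯ xₙ ↓ y` for some `y ≤ f(x)`. -/
def Represents {n : ℕ} {T : C} (a : T ⟶ A.carrier) (f : PartialArrow (A.pow n) A.carrier) : Prop :=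
  ∀ ⦃S : C⦄ (s : S ⟶ T) (x : S ⟶ A.pow n),
    (∀ i < n, ∃ y, A.AppList (s ≫ a) ((A.coords x).take i) y) ∧
    ∀ z, f.Val x z → ∃ y, A.Le y z ∧ A.AppList (s ≫ a) (A.coords x) y

end FiniteLimits

end OPAS

/-! ### Helper facts: the object of realizers -/

section Helpers

variable {C : Type u} [Category.{v} C]

namespace PartialArrow

theorem Val.precomp {X Y : C} {f : PartialArrow X Y} {T S : C} {x : T ⟶ X} {y : T ⟶ Y}
    (h : f.Val x y) (s : S ⟶ T) : f.Val (s ≫ x) (s ≫ y) := by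
  obtain ⟨h, rfl⟩ := h
  exact ⟨Subobject.factors_of_factors_right s h, by rw [← Subobject.factorThru_right _ _ h]; simp⟩

theorem Val.unique {X Y : C} {f : PartialArrow X Y} {T : C} {x : T ⟶ X} {y z : T ⟶ Y}
    (h : f.Val x y) (h' : f.Val x z) : y = z := by
  obtain ⟨_, rfl⟩ := h
  obtain ⟨_, rfl⟩ := h'
  rfl

theorem val_of_fac {X Y : C} (f : PartialArrow X Y) {T : C} (t : T ⟶ (f.dom : C)) :
    f.Val (t ≫ f.dom.arrow) (t ≫ f.map) :=
  ⟨Subobject.factors_comp_arrow t, by rw [Subobject.factorThru_comp_arrow]⟩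

theorem val_iff {X Y : C} (f : PartialArrow X Y) {T : C} (x : T ⟶ X) (y : T ⟶ Y) :
    f.Val x y ↔ ∃ t : T ⟶ (f.dom : C), t ≫ f.dom.arrow = x ∧ t ≫ f.map = y := by
  constructor
  · rintro ⟨h, rfl⟩
    exact ⟨f.dom.factorThru x h, by simp, rfl⟩
  · rintro ⟨t, rfl, rfl⟩
    exact f.val_of_fac t

theorem factors_iff_exists_val {X Y : C} (f : PartialArrow X Y) {T : C} (x : T ⟶ X) :
    f.dom.Factors x ↔ ∃ y, f.Val x y :=
  ⟨fun h => ⟨_, h, rfl⟩, fun ⟨_, h, _⟩ => h⟩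

theorem ofHom_val {X Y : C} (f : X ⟶ Y) {T : C} (x : T ⟶ X) (y : T ⟶ Y) :
    (ofHom f).Val x y ↔ x ≫ f = y := by
  constructor
  · rintro ⟨h, rfl⟩
    exact (Subobject.factorThru_arrow_assoc (⊤ : Subobject X) x h f).symm
  · rintro rfl
    exact ⟨Subobject.top_factors x,
      Subobject.factorThru_arrow_assoc (⊤ : Subobject X) x (Subobject.top_factors x) f⟩

variable [HasFiniteLimits C]

theorem pair_val {X Y Z : C} (f : PartialArrow X Y) (g : PartialArrow X Z) {T : C} (x : T ⟶ X)
    (w : T ⟶ Y ⨯ Z) : (f.pair g).Val x w ↔ f.Val x (w ≫ prod.fst) ∧ g.Val x (w ≫ prod.snd) := by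
  constructor
  · rw [val_iff]
    rintro ⟨t, rfl, rfl⟩
    have l1 : (f.pair g).dom ≤ f.dom := (inf_le_left : f.dom ⊓ g.dom ≤ f.dom)
    have l2 : (f.pair g).dom ≤ g.dom := (inf_le_right : f.dom ⊓ g.dom ≤ g.dom)
    have h1 := f.val_of_fac (t ≫ Subobject.ofLE _ _ l1)
    have h2 := g.val_of_fac (t ≫ Subobject.ofLE _ _ l2)
    rw [Category.assoc, Category.assoc] at h1 h2
    rw [Subobject.ofLE_arrow] at h1 h2
    rw [Category.assoc, Category.assoc]
    simp only [pair, prod.lift_fst, prod.lift_snd]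
    exact ⟨h1, h2⟩
  · rintro ⟨⟨h1, e1⟩, ⟨h2, e2⟩⟩
    have h : (f.dom ⊓ g.dom).Factors x := (Subobject.inf_factors x).2 ⟨h1, h2⟩
    refine ⟨h, ?_⟩
    apply Limits.prod.hom_ext
    · rw [← e1]
      have := Subobject.factorThru_ofLE (inf_le_left : f.dom ⊓ g.dom ≤ f.dom) h
      rw [Category.assoc]
      simp only [pair, prod.lift_fst]
      rw [this, Category.assoc]
    · rw [← e2]
      have := Subobject.factorThru_ofLE (inf_le_right : f.dom ⊓ g.dom ≤ g.dom) h
      rw [Category.assoc]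
      simp only [pair, prod.lift_snd]
      rw [this, Category.assoc]

theorem comp_val {X Y Z : C} (f : PartialArrow X Y) (g : PartialArrow Y Z) {T : C} (x : T ⟶ X)
    (z : T ⟶ Z) : (f.comp g).Val x z ↔ ∃ y, f.Val x y ∧ g.Val y z := by
  have w := (Subobject.isPullback f.map g.dom).w
  constructor
  · rw [val_iff]
    rintro ⟨t, rfl, rfl⟩
    let i : ((f.comp g).dom : C) ⟶ (((Subobject.pullback f.map).obj g.dom : Subobject _) : C) :=
      (Subobject.underlyingIso
      (((Subobject.pullback f.map).obj g.dom).arrow ≫ f.dom.arrow)).hom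
    refine ⟨(t ≫ i) ≫ ((Subobject.pullback f.map).obj g.dom).arrow ≫ f.map, ?_, ?_⟩
    · rw [val_iff]
      refine ⟨(t ≫ i) ≫ ((Subobject.pullback f.map).obj g.dom).arrow, ?_, Category.assoc _ _ _⟩
      have hi : i ≫ ((Subobject.pullback f.map).obj g.dom).arrow ≫ f.dom.arrow =
        (f.comp g).dom.arrow := Subobject.underlyingIso_hom_comp_eq_mk _
      rw [Category.assoc, Category.assoc, hi]
    · rw [val_iff]
      refine ⟨(t ≫ i) ≫ Subobject.pullbackπ f.map g.dom, by rw [Category.assoc, w], ?_⟩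
      rw [Category.assoc, Category.assoc]
      rfl
  · rintro ⟨y, hf, hg⟩
    rw [val_iff] at hf hg
    obtain ⟨t, rfl, rfl⟩ := hf
    obtain ⟨r, hr, rfl⟩ := hg
    let q := (Subobject.isPullback f.map g.dom).lift r t hr
    have q1 : q ≫ Subobject.pullbackπ f.map g.dom = r := IsPullback.lift_fst _ _ _ _
    have q2 : q ≫ ((Subobject.pullback f.map).obj g.dom).arrow = t := IsPullback.lift_snd _ _ _ _
    rw [val_iff]
    refine ⟨q ≫ (Subobject.underlyingIso _).inv, ?_, ?_⟩
    · simp only [comp, Category.assoc, Subobject.underlyingIso_arrow]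
      rw [← Category.assoc, q2]
    · simp only [comp, Category.assoc, Iso.inv_hom_id_assoc]
      rw [← Category.assoc, q1]

end PartialArrow

theorem factors_pullback_iff [HasFiniteLimits C] {X Y : C} (f : X ⟶ Y) (V : Subobject Y) {T : C}
    (x : T ⟶ X) : ((Subobject.pullback f).obj V).Factors x ↔ V.Factors (x ≫ f) := by
  have P := Subobject.isPullback f V
  constructor
  · intro h
    have : x ≫ f = (Subobject.factorThru _ x h ≫ Subobject.pullbackπ f V) ≫ V.arrow := by
      rw [Category.assoc, P.w, Subobject.factorThru_arrow_assoc]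
    rw [this]
    exact Subobject.factors_comp_arrow _
  · intro h
    have : x = P.lift (V.factorThru _ h) x (by simp) ≫ ((Subobject.pullback f).obj V).arrow := by
      simp
    rw [this]
    exact Subobject.factors_comp_arrow _

/-- Membership of a subobject is local for strong epimorphisms. -/
theorem factors_of_cover {X T S : C} (U : Subobject X) (e : S ⟶ T) [StrongEpi e] (x : T ⟶ X)
    (h : U.Factors (e ≫ x)) : U.Factors x := by
  have sq : CommSq (U.factorThru _ h) e U.arrow x := ⟨by simp⟩
  rw [← sq.fac_right]
  exact Subobject.factors_comp_arrow _

theorem isRegularEpi_comp [Regular C] {X Y Z : C} (f : X ⟶ Y) (g : Y ⟶ Z) [IsRegularEpi f]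
    [IsRegularEpi g] : IsRegularEpi (f ≫ g) := by
  have : ExtremalEpi (f ≫ g) := extremalEpi_iff_strongEpi_of_hasPullbacks _ |>.2 inferInstance
  infer_instance

theorem isRegularEpi_of_comp [Regular C] {X Y Z : C} (f : X ⟶ Y) (g : Y ⟶ Z)
    [IsRegularEpi (f ≫ g)] : IsRegularEpi g := by
  have : StrongEpi g := strongEpi_of_strongEpi f g
  have : ExtremalEpi g := extremalEpi_iff_strongEpi_of_hasPullbacks _ |>.2 inferInstance
  infer_instance

theorem intersects_iff [Regular C] {X : C} (U V : Subobject X) :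
    Intersects U V ↔ ∃ (T : C) (a : T ⟶ X),
      IsRegularEpi (terminal.from T) ∧ U.Factors a ∧ V.Factors a := by
  constructor
  · intro h
    have := (Subobject.inf_factors (X := U) (Y := V) (U ⊓ V).arrow).1 (Subobject.factors_self _)
    exact ⟨_, (U ⊓ V).arrow, h, this⟩
  · rintro ⟨T, a, h, hU, hV⟩
    have hUV : (U ⊓ V).Factors a := (Subobject.inf_factors a).2 ⟨hU, hV⟩
    have : (U ⊓ V).factorThru a hUV ≫ terminal.from _ = terminal.from T := Subsingleton.elim _ _
    rw [← this] at h
    exact isRegularEpi_of_comp ((U ⊓ V).factorThru a hUV) _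

/-- Any element of a regular category's object factors as a cover followed by a subobject. -/
theorem exists_image [Regular C] {X T : C} (x : T ⟶ X) :
    ∃ (I : Subobject X) (e : T ⟶ (I : C)), IsRegularEpi e ∧ e ≫ I.arrow = x := by
  let F := Regular.strongEpiMonoFactorisation x
  have : IsRegularEpi F.e := inferInstanceAs (IsRegularEpi (Regular.strongEpiMonoFactorisation x).e)
  refine ⟨Subobject.mk F.m, F.e ≫ (Subobject.underlyingIso F.m).inv, ?_, by simp⟩
  have : ExtremalEpi (F.e ≫ (Subobject.underlyingIso F.m).inv) :=
    extremalEpi_iff_strongEpi_of_hasPullbacks _ |>.2 inferInstance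
  infer_instance

/-- Universal quantification along `f`, described by generalized elements. -/
theorem exists_forall [HeytingCategory C] {X Y : C} (f : Y ⟶ X) (U : Subobject Y) :
    ∃ V : Subobject X, ∀ {T : C} (x : T ⟶ X), V.Factors x ↔
      ∀ ⦃S : C⦄ (s : S ⟶ T) (y : S ⟶ Y), y ≫ f = s ≫ x → U.Factors y := by
  obtain ⟨all, gc⟩ := HeytingCategory.exists_all f
  refine ⟨all U, fun {T} x => ⟨fun h S s y e => ?_, fun h => ?_⟩⟩
  · have h1 : (all U).Factors (y ≫ f) := e ▸ Subobject.factors_of_factors_right s h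
    exact Subobject.factors_of_le y ((gc _ _).2 le_rfl) ((factors_pullback_iff f _ y).2 h1)
  · obtain ⟨I, e, he, rfl⟩ := exists_image x
    refine Subobject.factors_of_le _ ((gc I U).1 ?_) (Subobject.factors_comp_arrow e)
    apply Subobject.le_of_factors
    refine factors_of_cover U (pullback.fst (Subobject.pullbackπ f I) e) _ ?_
    refine h (pullback.snd (Subobject.pullbackπ f I) e) _ ?_
    rw [Category.assoc, ← (Subobject.isPullback f I).w, ← Category.assoc, pullback.condition,
      Category.assoc]

namespace OPAS

variable [HasFiniteLimits C] (A : OPAS C)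

theorem mul_val {X : C} (f g : PartialArrow X A.carrier) {T : C} (x : T ⟶ X) (z : T ⟶ A.carrier) :
    (A.mul f g).Val x z ↔ ∃ a b, f.Val x a ∧ g.Val x b ∧ A.App a b z := by
  rw [mul, PartialArrow.comp_val]
  constructor
  · rintro ⟨w, h, h'⟩
    rw [PartialArrow.pair_val] at h
    refine ⟨_, _, h.1, h.2, ?_⟩
    rw [App]
    convert h' using 1
    apply Limits.prod.hom_ext <;> simp only [prod.lift_fst, prod.lift_snd]
  · rintro ⟨a, b, ha, hb, h⟩
    exact ⟨prod.lift a b, by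
      rw [PartialArrow.pair_val, prod.lift_fst, prod.lift_snd]; exact ⟨ha, hb⟩, h⟩

theorem App.precomp {A : OPAS C} {T S : C} {a b c : T ⟶ A.carrier} (h : A.App a b c) (s : S ⟶ T) :
    A.App (s ≫ a) (s ≫ b) (s ≫ c) := by
  have := PartialArrow.Val.precomp h s
  rwa [prod.comp_lift] at this

theorem AppList.precomp {A : OPAS C} {T S : C} {a y : T ⟶ A.carrier} {xs : List (T ⟶ A.carrier)}
    (h : A.AppList a xs y) (s : S ⟶ T) : A.AppList (s ≫ a) (xs.map (s ≫ ·)) (s ≫ y) := by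
  induction xs generalizing a with
  | nil => simp only [AppList, List.map_nil] at h ⊢; rw [h]
  | cons x xs ih =>
    obtain ⟨b, h1, h2⟩ := h
    exact ⟨s ≫ b, h1.precomp s, ih h2⟩

/-- Iterated application is a partial arrow. -/
theorem exists_appList {Γ : C} (p : PartialArrow Γ A.carrier) (xs : List (Γ ⟶ A.carrier)) :
    ∃ q : PartialArrow Γ A.carrier, ∀ {T : C} (w : T ⟶ Γ) (y : T ⟶ A.carrier),
      q.Val w y ↔ ∃ c, p.Val w c ∧ A.AppList c (xs.map (w ≫ ·)) y := by
  induction xs generalizing p with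
  | nil => exact ⟨p, fun w y => by simp [AppList]⟩
  | cons x xs ih =>
    obtain ⟨q, hq⟩ := ih (A.mul p (PartialArrow.ofHom x))
    refine ⟨q, fun w y => ?_⟩
    rw [hq]
    constructor
    · rintro ⟨c, h1, h2⟩
      obtain ⟨a, b, ha, hb, h⟩ := (A.mul_val _ _ _ _).1 h1
      rw [PartialArrow.ofHom_val] at hb
      subst hb
      exact ⟨a, ha, c, h, h2⟩
    · rintro ⟨c, h1, b, h2, h3⟩
      exact ⟨b, (A.mul_val _ _ _ _).2 ⟨c, _, h1, (PartialArrow.ofHom_val _ _ _).2 rfl, h2⟩, h3⟩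

theorem coords_comp {n : ℕ} {T S : C} (s : S ⟶ T) (x : T ⟶ A.pow n) :
    A.coords (s ≫ x) = (A.coords x).map (s ≫ ·) := by
  simp [coords, List.map_ofFn, Function.comp_def]

end OPAS

/-- The representing elements form a subobject. -/
theorem OPAS.exists_realizers [HeytingCategory C] (A : OPAS C) {n : ℕ}
    (f : PartialArrow (A.pow n) A.carrier) :
    ∃ R : Subobject A.carrier, ∀ {T : C} (a : T ⟶ A.carrier), R.Factors a ↔ A.Represents a f := by
  have h1 : ∀ i : ℕ, ∃ R : Subobject A.carrier, ∀ {T : C} (a : T ⟶ A.carrier), R.Factors a ↔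
      ∀ ⦃S : C⦄ (s : S ⟶ T) (x : S ⟶ A.pow n),
        ∃ y, A.AppList (s ≫ a) ((A.coords x).take i) y := by
    intro i
    obtain ⟨q, hq⟩ := A.exists_appList
      (PartialArrow.ofHom (prod.fst : A.carrier ⨯ A.pow n ⟶ A.carrier))
      ((A.coords (prod.snd : A.carrier ⨯ A.pow n ⟶ A.pow n)).take i)
    have hq' : ∀ {S : C} (w : S ⟶ A.carrier ⨯ A.pow n), q.dom.Factors w ↔
        ∃ y, A.AppList (w ≫ prod.fst) ((A.coords (w ≫ prod.snd)).take i) y := by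
      intro S w
      simp only [q.factors_iff_exists_val, hq, PartialArrow.ofHom_val, exists_eq_left',
        A.coords_comp, List.map_take]
    obtain ⟨R, hR⟩ := exists_forall (prod.fst : A.carrier ⨯ A.pow n ⟶ A.carrier) q.dom
    refine ⟨R, fun {T} a => ?_⟩
    rw [hR]
    constructor
    · intro h S s x
      have := (hq' _).1 (h s (prod.lift (s ≫ a) x) (prod.lift_fst _ _))
      simpa only [prod.lift_fst, prod.lift_snd] using this
    · intro h S s w e
      rw [hq', e]
      exact h s _
  have h2 : ∃ R : Subobject A.carrier, ∀ {T : C} (a : T ⟶ A.carrier), R.Factors a ↔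
      ∀ ⦃S : C⦄ (s : S ⟶ T) (x : S ⟶ A.pow n) (z : S ⟶ A.carrier), f.Val x z →
        ∃ y, A.Le y z ∧ A.AppList (s ≫ a) (A.coords x) y := by
    let D : C := (f.dom : C)
    obtain ⟨q, hq⟩ := A.exists_appList
      (PartialArrow.ofHom (prod.fst : A.carrier ⨯ D ⟶ A.carrier))
      (A.coords ((prod.snd : A.carrier ⨯ D ⟶ D) ≫ f.dom.arrow))
    let r : PartialArrow (A.carrier ⨯ D) (A.le : C) :=
      (q.pair (PartialArrow.ofHom ((prod.snd : A.carrier ⨯ D ⟶ D) ≫ f.map))).comp ⟨A.le, 𝟙 _⟩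
    have hr : ∀ {S : C} (w : S ⟶ A.carrier ⨯ D), r.dom.Factors w ↔
        ∃ y, A.Le y ((w ≫ prod.snd) ≫ f.map) ∧
          A.AppList (w ≫ prod.fst) (A.coords ((w ≫ prod.snd) ≫ f.dom.arrow)) y := by
      intro S w
      rw [r.factors_iff_exists_val]
      constructor
      · rintro ⟨z, hz⟩
        obtain ⟨p, h, h', _⟩ := (PartialArrow.comp_val _ _ _ _).1 hz
        obtain ⟨ha, hb⟩ := (PartialArrow.pair_val _ _ _ _).1 h
        rw [PartialArrow.ofHom_val] at hb
        obtain ⟨c, hc, hl⟩ := (hq _ _).1 ha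
        rw [PartialArrow.ofHom_val] at hc
        subst hc
        refine ⟨p ≫ prod.fst, ?_, ?_⟩
        · rw [OPAS.Le]
          convert h' using 1
          apply Limits.prod.hom_ext
          · rw [prod.lift_fst]
          · rw [prod.lift_snd, ← hb, Category.assoc]
        · rwa [Category.assoc, A.coords_comp w]
      · rintro ⟨y, hl, ha⟩
        refine ⟨_, (PartialArrow.comp_val _ _ _ _).2
          ⟨prod.lift y ((w ≫ prod.snd) ≫ f.map), ?_, hl, rfl⟩⟩
        rw [PartialArrow.pair_val]
        constructor
        · rw [prod.lift_fst, hq]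
          refine ⟨_, (PartialArrow.ofHom_val _ _ _).2 rfl, ?_⟩
          rwa [← A.coords_comp w, ← Category.assoc]
        · rw [prod.lift_snd, PartialArrow.ofHom_val, Category.assoc]
    obtain ⟨R, hR⟩ := exists_forall (prod.fst : A.carrier ⨯ D ⟶ A.carrier) r.dom
    refine ⟨R, fun {T} a => ?_⟩
    rw [hR]
    constructor
    · intro h S s x z hz
      obtain ⟨t, rfl, rfl⟩ := (f.val_iff _ _).1 hz
      have := (hr _).1 (h s (prod.lift (s ≫ a) t) (prod.lift_fst _ _))
      simpa only [prod.lift_fst, prod.lift_snd] using this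
    · intro h S s w e
      rw [hr, e]
      exact h s _ _ (f.val_of_fac _)
  choose R1 hR1 using h1
  obtain ⟨R2, hR2⟩ := h2
  refine ⟨(Finset.range n).inf R1 ⊓ R2, fun {T} a => ?_⟩
  rw [Subobject.inf_factors, Subobject.finset_inf_factors, hR2]
  constructor
  · rintro ⟨h1, h2⟩ S s x
    exact ⟨fun i hi => (hR1 i a).1 (h1 i (Finset.mem_range.2 hi)) s x, h2 s x⟩
  · intro h
    exact ⟨fun i hi => (hR1 i a).2 fun S s x => (h s x).1 i (Finset.mem_range.1 hi),
      fun S s x => (h s x).2⟩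

end Helpers

/-! ### OPCA pairs -/

section Pairs

variable {C : Type u} [Category.{v} C] [HeytingCategory C]

/-- The object of realizers `⟦f⟧`: the subobject of all elements of `A` that represent `f`. -/
noncomputable def OPAS.realizers (A : OPAS C) {n : ℕ} (f : PartialArrow (A.pow n) A.carrier) :
    Subobject A.carrier :=
  Classical.choose (A.exists_realizers f)

theorem OPAS.mem_realizers (A : OPAS C) {n : ℕ} (f : PartialArrow (A.pow n) A.carrier) {T : C}
    (a : T ⟶ A.carrier) : (A.realizers f).Factors a ↔ A.Represents a f :=
  Classical.choose_spec (A.exists_realizers f) a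

variable (C) in
/-- An OPCA pair `(A', A)`: an ordered partial applicative structure `A` and a subobject `A'`,
with the restricted order and application, that is closed under application and intersects the
object of realizers of every partial combinatory arrow. -/
structure OPCAPair where
  A : OPAS C
  /-- the subobject `A'` -/
  sub : Subobject A.carrier
  sub_app {T : C} (a b c : T ⟶ A.carrier) :
    sub.Factors a → sub.Factors b → A.App a b c → sub.Factors c
  combinatory {n : ℕ} (f : PartialArrow (A.pow n) A.carrier) :
    A.IsCombinatory n f → Intersects (A.realizers f) sub

/-! ### Assemblies -/

/-- An assembly `(X, Y)` for the OPCA pair `(A', A)`: an object `X` and a subobject `Y` of `A × X`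
that projects onto `X` and is downward closed in `A`. -/
structure Assembly (P : OPCAPair C) where
  X : C
  Y : Subobject (P.A.carrier ⨯ X)
  cover : IsRegularEpi (Y.arrow ≫ prod.snd)
  down {T : C} (a b : T ⟶ P.A.carrier) (x : T ⟶ X) :
    Y.Factors (prod.lift a x) → P.A.Le b a → Y.Factors (prod.lift b x)

namespace Assembly

variable {P : OPCAPair C}

/-- `V` tracks `f`: for all `a` in `V` and `(b, x)` in `Y`, the application `ab` is defined and
`(ab, f(x))` is in `Y'`. -/
def Tracks (M N : Assembly P) (V : Subobject P.A.carrier) (f : M.X ⟶ N.X) : Prop :=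
  ∀ ⦃T : C⦄ (a b : T ⟶ P.A.carrier) (x : T ⟶ M.X),
    V.Factors a → M.Y.Factors (prod.lift b x) →
      ∃ c : T ⟶ P.A.carrier, P.A.App a b c ∧ N.Y.Factors (prod.lift c (x ≫ f))

/-- A morphism of assemblies is an arrow that is tracked by a subobject that intersects `A'`. -/
@[ext]
structure Hom (M N : Assembly P) where
  hom : M.X ⟶ N.X
  tracked : ∃ V : Subobject P.A.carrier, Intersects V P.sub ∧ Tracks M N V hom

theorem id_tracked (M : Assembly P) :
    ∃ V : Subobject P.A.carrier, Intersects V P.sub ∧ Tracks M M V (𝟙 M.X) := by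
  refine ⟨_, P.combinatory _ (OPAS.IsCombinatory.proj (n := 1) 0), ?_⟩
  intro T a b x ha hb
  rw [OPAS.mem_realizers] at ha
  obtain ⟨y, hy, h⟩ := (ha (𝟙 T) (Pi.lift fun _ => b)).2 b
    ((PartialArrow.ofHom_val _ _ _).2 (by simp))
  simp only [OPAS.coords, List.ofFn_succ, List.ofFn_zero, OPAS.AppList, Category.id_comp,
    Pi.lift_π] at h
  obtain ⟨c, h, rfl⟩ := h
  exact ⟨c, h, by simpa using M.down b c x hb hy⟩

theorem comp_tracked {M N K : Assembly P} (f : M.X ⟶ N.X) (g : N.X ⟶ K.X)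
    (hf : ∃ V : Subobject P.A.carrier, Intersects V P.sub ∧ Tracks M N V f)
    (hg : ∃ V : Subobject P.A.carrier, Intersects V P.sub ∧ Tracks N K V g) :
    ∃ V : Subobject P.A.carrier, Intersects V P.sub ∧ Tracks M K V (f ≫ g) := by
  obtain ⟨U, hU, tU⟩ := hf
  obtain ⟨V, hV, tV⟩ := hg
  let pr (i : Fin 3) : PartialArrow (P.A.pow 3) P.A.carrier :=
    PartialArrow.ofHom (Pi.π (fun _ : Fin 3 => P.A.carrier) i)
  have hB := P.combinatory (P.A.mul (pr 0) (P.A.mul (pr 1) (pr 2)))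
    (.mul _ _ (.proj 0) (.mul _ _ (.proj 1) (.proj 2)))
  rw [intersects_iff] at hU hV hB
  obtain ⟨T₁, u, e₁, u1, u2⟩ := hU
  obtain ⟨T₂, w, e₂, w1, w2⟩ := hV
  obtain ⟨T₃, β, e₃, b1, b2⟩ := hB
  let T₄ := pullback (terminal.from T₁) (terminal.from T₂)
  have e₄ : IsRegularEpi (terminal.from T₄) := by
    have : pullback.fst (terminal.from T₁) (terminal.from T₂) ≫ terminal.from T₁ =
      terminal.from T₄ := Subsingleton.elim _ _
    rw [← this]
    exact isRegularEpi_comp _ _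
  let T := pullback (terminal.from T₄) (terminal.from T₃)
  have e : IsRegularEpi (terminal.from T) := by
    have : pullback.fst (terminal.from T₄) (terminal.from T₃) ≫ terminal.from T₄ =
      terminal.from T := Subsingleton.elim _ _
    rw [← this]
    exact isRegularEpi_comp _ _
  let p : T ⟶ T₄ := pullback.fst _ _
  obtain ⟨u, hu1, hu2⟩ : ∃ u : T ⟶ P.A.carrier, U.Factors u ∧ P.sub.Factors u :=
    ⟨(p ≫ pullback.fst _ _) ≫ u, Subobject.factors_of_factors_right _ u1,
      Subobject.factors_of_factors_right _ u2⟩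
  obtain ⟨w, hw1, hw2⟩ : ∃ w : T ⟶ P.A.carrier, V.Factors w ∧ P.sub.Factors w :=
    ⟨(p ≫ pullback.snd _ _) ≫ w, Subobject.factors_of_factors_right _ w1,
      Subobject.factors_of_factors_right _ w2⟩
  obtain ⟨β, hb1, hb2⟩ : ∃ b : T ⟶ P.A.carrier,
      (P.A.realizers (P.A.mul (pr 0) (P.A.mul (pr 1) (pr 2)))).Factors b ∧ P.sub.Factors b :=
    ⟨pullback.snd (terminal.from T₄) (terminal.from T₃) ≫ β,
      Subobject.factors_of_factors_right _ b1, Subobject.factors_of_factors_right _ b2⟩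
  rw [OPAS.mem_realizers] at hb1
  obtain ⟨d, c, hc, d', hd, hdd⟩ := (hb1 (𝟙 T) (Pi.lift ![w, u, u])).1 2 (by norm_num)
  simp only [Category.id_comp, Pi.lift_π, List.take, OPAS.AppList] at hc hd hdd
  subst hdd
  obtain ⟨I, q, hq, rfl⟩ := exists_image d'
  refine ⟨I, (intersects_iff _ _).2 ⟨T, q ≫ I.arrow, e, Subobject.factors_comp_arrow _,
    P.sub_app _ _ _ (P.sub_app _ _ _ hb2 hw2 hc) hu2 hd⟩, ?_⟩
  intro S a b x ha hb
  let S' := pullback (I.factorThru a ha) q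
  let ε : S' ⟶ S := pullback.fst _ _
  let t : S' ⟶ T := pullback.snd _ _
  have hε : StrongEpi ε := inferInstance
  have hat : ε ≫ a = t ≫ q ≫ I.arrow := by
    rw [← Category.assoc t, ← pullback.condition, Category.assoc, Subobject.factorThru_arrow]
  have hb' : M.Y.Factors (prod.lift (ε ≫ b) (ε ≫ x)) := by
    rw [← prod.comp_lift]
    exact Subobject.factors_of_factors_right _ hb
  obtain ⟨c₁, h1, m1⟩ := tU (t ≫ u) (ε ≫ b) (ε ≫ x) (Subobject.factors_of_factors_right _ hu1) hb'
  obtain ⟨c₂, h2, m2⟩ := tV (t ≫ w) c₁ _ (Subobject.factors_of_factors_right _ hw1) m1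
  obtain ⟨y, hy, r₁, hr₁, r₂, hr₂, r₃, hr₃, rfl⟩ :=
    (hb1 t (Pi.lift ![t ≫ w, t ≫ u, ε ≫ b])).2 c₂ (by
      rw [OPAS.mul_val]
      refine ⟨t ≫ w, c₁, (PartialArrow.ofHom_val _ _ _).2 (by simp), ?_, h2⟩
      rw [OPAS.mul_val]
      exact ⟨t ≫ u, ε ≫ b, (PartialArrow.ofHom_val _ _ _).2 (by simp),
        (PartialArrow.ofHom_val _ _ _).2 (by simp), h1⟩)
  simp only [Pi.lift_π] at hr₁ hr₂
  obtain rfl := PartialArrow.Val.unique hr₁ (hc.precomp t)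
  obtain rfl := PartialArrow.Val.unique hr₂ (hd.precomp t)
  have hr₃' : P.A.App (ε ≫ a) (ε ≫ b) r₃ := by
    rw [hat]
    simpa using hr₃
  have hdom : P.A.app.dom.Factors (prod.lift a b) := by
    refine factors_of_cover _ ε _ ?_
    rw [prod.comp_lift]
    exact hr₃'.1
  obtain ⟨z, hz⟩ := (PartialArrow.factors_iff_exists_val _ _).1 hdom
  refine ⟨z, hz, factors_of_cover _ ε _ ?_⟩
  obtain rfl := PartialArrow.Val.unique hr₃' (OPAS.App.precomp hz ε)
  rw [prod.comp_lift]
  simpa using K.down _ _ _ m2 hy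

/-- The category of assemblies. -/
instance : Category (Assembly P) where
  Hom := Hom
  id M := ⟨𝟙 M.X, id_tracked M⟩
  comp f g := ⟨f.hom ≫ g.hom, comp_tracked f.hom g.hom f.tracked g.tracked⟩
  id_comp f := Hom.ext (Category.id_comp f.hom)
  comp_id f := Hom.ext (Category.comp_id f.hom)
  assoc f g h := Hom.ext (Category.assoc f.hom g.hom h.hom)

end Assembly

end Pairs

/-! ### Membership in images, joins and bottom subobjects -/

section Subobjects

variable {C : Type u} [Category.{v} C]

/-! Downward closed relations between `A` and `X`, preordered by uniform entailment, behave like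
first order predicates fibred over the base category. Conjunction, disjunction and falsity come from
combinatory terms. The map `ex` is left adjoint to reindexing (`ex_le_iff`), and `allImp`, a
universal quantifier bounded by a predicate, is right adjoint to reindexing followed by conjunction
(`le_allImp`, `inf_le_of_le_allImp`). Beck–Chevalley and Frobenius hold.

An assembly is such a predicate with full support, and an arrow `f` is a morphism exactly when
`M.pred ≤ N.pred.pull f`. Each claim about assemblies thus splits into one about the base and an
entailment. Pullbacks carry the conjunction of the two predicates (`isPullback_iff`). Regular
epimorphisms are those of the base for which `N.pred ≤ ex f M.pred` (`isRegularEpi_iff`). Subobjects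
of `M` are, up to equivalence, the predicates below `M.pred` (`subPred_le_iff`, `exists_subPred`),
so the Heyting structure and both quantifiers are inherited. Exponentials in a slice are those of
the base, restricted to the functions that have a tracker (`Assembly.hasExponential`).

Realizers exist only locally. Finitely many are picked in `A'` at one inhabited stage `T`
(`exists_common_stage`), a term turns them into an element of `A'` at `T`, and the image of that
element is the required tracking subobject (`le_of_stage`). Definedness and membership descend along
covers. Terms are represented only up to `≤`, which downward closure absorbs. -/

/-- The image of `g`, described by generalized elements. -/
theorem exists_image_mem [Regular C] {G X : C} (g : G ⟶ X) :
    ∃ I : Subobject X, ∀ {T : C} (x : T ⟶ X), I.Factors x ↔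
      ∃ (S : C) (e : S ⟶ T) (y : S ⟶ G), IsRegularEpi e ∧ y ≫ g = e ≫ x := by
  obtain ⟨I, q, hq, rfl⟩ := exists_image g
  refine ⟨I, fun {T} x => ⟨fun h => ?_, ?_⟩⟩
  · refine ⟨pullback (I.factorThru x h) q, pullback.fst _ _, pullback.snd _ _, inferInstance, ?_⟩
    rw [← Category.assoc, ← pullback.condition, Category.assoc, Subobject.factorThru_arrow]
  · rintro ⟨S, e, y, he, h⟩
    refine factors_of_cover I e x ?_
    rw [← h, ← Category.assoc]
    exact Subobject.factors_comp_arrow _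

/-- Binary joins of subobjects, with their elimination rule in context. -/
theorem exists_sup [HeytingCategory C] {X : C} (U V : Subobject X) :
    ∃ W : Subobject X, U ≤ W ∧ V ≤ W ∧ ∀ {T : C} (x : T ⟶ X) (R : Subobject T), W.Factors x →
      (∀ ⦃S : C⦄ (s : S ⟶ T), U.Factors (s ≫ x) → R.Factors s) →
      (∀ ⦃S : C⦄ (s : S ⟶ T), V.Factors (s ≫ x) → R.Factors s) → R.Factors (𝟙 T) := by
  obtain ⟨H, hH⟩ := HeytingCategory.heyting X
  refine ⟨H.sup U V, (hH _ _).1 (H.le_sup_left U V), (hH _ _).1 (H.le_sup_right U V),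
    fun {T} x R hx hU hV => ?_⟩
  -- `A` is `∀ₓ R`. Each case says that a disjunct lies below it, hence so does the join; this
  -- replaces stability of joins under pullback.
  obtain ⟨A, hA⟩ := exists_forall x R
  have key : ∀ U' : Subobject X, (∀ ⦃S : C⦄ (s : S ⟶ T), U'.Factors (s ≫ x) → R.Factors s) →
      U' ≤ A := fun U' h => Subobject.le_of_factors ((hA _).2 fun S s y e =>
    h y (e ▸ Subobject.factors_comp_arrow s))
  have hW : H.sup U V ≤ A :=
    (hH _ _).1 (H.sup_le U V A ((hH _ _).2 (key U hU)) ((hH _ _).2 (key V hV)))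
  exact (hA x).1 (Subobject.factors_of_le x hW hx) (𝟙 T) (𝟙 T) rfl

/-- The bottom subobject, with its elimination rule in context. -/
theorem exists_bot [HeytingCategory C] (X : C) :
    ∃ W : Subobject X, ∀ {T : C} (x : T ⟶ X) (R : Subobject T), W.Factors x → R.Factors (𝟙 T) := by
  obtain ⟨H, hH⟩ := HeytingCategory.heyting X
  refine ⟨H.bot, fun {T} x R hx => ?_⟩
  obtain ⟨A, hA⟩ := exists_forall x R
  exact (hA x).1 (Subobject.factors_of_le x ((hH _ _).1 (H.bot_le A)) hx) (𝟙 T) (𝟙 T) rfl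

theorem isRegularEpi_iff_strongEpi [Regular C] {X Y : C} (f : X ⟶ Y) :
    IsRegularEpi f ↔ StrongEpi f := by
  refine ⟨fun _ => inferInstance, fun _ => ?_⟩
  have : ExtremalEpi f := extremalEpi_iff_strongEpi_of_hasPullbacks _ |>.2 inferInstance
  infer_instance

theorem isRegularEpi_terminal_from_comp [Regular C] {S T : C} (s : S ⟶ T) (hs : IsRegularEpi s)
    (hT : IsRegularEpi (terminal.from T)) : IsRegularEpi (terminal.from S) := by
  have : s ≫ terminal.from T = terminal.from S := Subsingleton.elim _ _
  rw [← this]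
  exact isRegularEpi_comp _ _

end Subobjects

/-! ### Terms and their realizers -/

/-- Applicative terms in `n` variables. -/
inductive CombTerm (n : ℕ) : Type
  | var (i : Fin n) : CombTerm n
  | app (t u : CombTerm n) : CombTerm n

namespace OPAS

variable {C : Type u} [Category.{v} C] [HasFiniteLimits C] (A : OPAS C)

/-- `A.Eval ρ t z` says that the value of `t` at `ρ` is defined and equal to `z`. -/
def Eval {n : ℕ} {T : C} (ρ : Fin n → (T ⟶ A.carrier)) : CombTerm n → (T ⟶ A.carrier) → Prop
  | .var i, z => ρ i = z
  | .app t u, z => ∃ a b, Eval ρ t a ∧ Eval ρ u b ∧ A.App a b z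

/-- The partial combinatory arrow defined by a term. -/
noncomputable def termArrow {n : ℕ} : CombTerm n → PartialArrow (A.pow n) A.carrier
  | .var i => PartialArrow.ofHom (Pi.π (fun _ : Fin n => A.carrier) i)
  | .app t u => A.mul (termArrow t) (termArrow u)

theorem isCombinatory_termArrow {n : ℕ} (t : CombTerm n) :
    A.IsCombinatory n (A.termArrow t) := by
  induction t with
  | var i => exact .proj i
  | app t u ht hu => exact .mul _ _ ht hu

theorem termArrow_val {n : ℕ} (t : CombTerm n) {T : C} (x : T ⟶ A.pow n) (z : T ⟶ A.carrier) :
    (A.termArrow t).Val x z ↔ A.Eval (fun i => x ≫ Pi.π (fun _ : Fin n => A.carrier) i) t z := by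
  induction t generalizing z with
  | var i => exact PartialArrow.ofHom_val _ _ _
  | app t u ht hu => simp only [termArrow, mul_val, Eval, ht, hu]

variable {A}

theorem AppList.unique {T : C} {a y z : T ⟶ A.carrier} {xs : List (T ⟶ A.carrier)}
    (h : A.AppList a xs y) (h' : A.AppList a xs z) : y = z := by
  induction xs generalizing a with
  | nil => exact h.symm.trans h'
  | cons x xs ih =>
    obtain ⟨b, h1, h2⟩ := h
    obtain ⟨c, h3, h4⟩ := h'
    obtain rfl := PartialArrow.Val.unique h1 h3
    exact ih h2 h4

theorem appList_append {T : C} (a y : T ⟶ A.carrier) (xs ys : List (T ⟶ A.carrier)) :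
    A.AppList a (xs ++ ys) y ↔ ∃ b, A.AppList a xs b ∧ A.AppList b ys y := by
  induction xs generalizing a with
  | nil => simp [AppList]
  | cons x xs ih =>
    simp only [List.cons_append, AppList, ih]
    constructor
    · rintro ⟨b, h, c, h1, h2⟩
      exact ⟨c, ⟨b, h, h1⟩, h2⟩
    · rintro ⟨c, ⟨b, h, h1⟩, h2⟩
      exact ⟨b, h, c, h1, h2⟩

theorem Le.precomp {T S : C} {a b : T ⟶ A.carrier} (h : A.Le a b) (s : S ⟶ T) :
    A.Le (s ≫ a) (s ≫ b) := by
  rw [Le, ← prod.comp_lift]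
  exact Subobject.factors_of_factors_right s h

end OPAS

namespace OPCAPair

variable {C : Type u} [Category.{v} C] [HeytingCategory C] (P : OPCAPair C)

/-- The realizers of a term. -/
noncomputable def realizer {n : ℕ} (t : CombTerm n) : Subobject P.A.carrier :=
  P.A.realizers (P.A.termArrow t)

theorem intersects_realizer {n : ℕ} (t : CombTerm n) : Intersects (P.realizer t) P.sub :=
  P.combinatory _ (P.A.isCombinatory_termArrow t)

variable {P}

/-- The restriction along `s` is built in because realizers live at an inhabited stage `T` while
their arguments arrive at later stages. -/
theorem realizer_spec {n : ℕ} {t : CombTerm n} {T : C} {a : T ⟶ P.A.carrier}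
    (ha : (P.realizer t).Factors a) {S : C} (s : S ⟶ T) (ρ : Fin n → (S ⟶ P.A.carrier)) :
    (∀ i < n, ∃ y, P.A.AppList (s ≫ a) ((List.ofFn ρ).take i) y) ∧
      ∀ z, P.A.Eval ρ t z → ∃ y, P.A.Le y z ∧ P.A.AppList (s ≫ a) (List.ofFn ρ) y := by
  rw [realizer, OPAS.mem_realizers] at ha
  have := ha s (Pi.lift ρ)
  simp only [OPAS.termArrow_val, OPAS.coords, Pi.lift_π] at this
  exact this

theorem appList_mem_sub {T : C} {a y : T ⟶ P.A.carrier} {xs : List (T ⟶ P.A.carrier)}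
    (ha : P.sub.Factors a) (hxs : ∀ x ∈ xs, P.sub.Factors x) (h : P.A.AppList a xs y) :
    P.sub.Factors y := by
  induction xs generalizing a with
  | nil => exact h ▸ ha
  | cons x xs ih =>
    obtain ⟨b, h1, h2⟩ := h
    rw [List.forall_mem_cons] at hxs
    exact ih (P.sub_app _ _ _ ha hxs.1 h1) hxs.2 h2

/-- Finitely many subobjects that intersect `A'` have elements in `A'` at a common inhabited
stage. -/
theorem exists_common_stage (l : List (Subobject P.A.carrier))
    (h : ∀ V ∈ l, Intersects V P.sub) :
    ∃ T : C, IsRegularEpi (terminal.from T) ∧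
      ∀ V ∈ l, ∃ v : T ⟶ P.A.carrier, V.Factors v ∧ P.sub.Factors v := by
  induction l with
  | nil =>
    have : IsIso (terminal.from (⊤_ C)) := by
      rw [Subsingleton.elim (terminal.from (⊤_ C)) (𝟙 _)]; infer_instance
    exact ⟨⊤_ C, (isRegularEpi_iff_strongEpi _).2 inferInstance, by simp⟩
  | cons V l ih =>
    rw [List.forall_mem_cons] at h
    obtain ⟨T, hT, hl⟩ := ih h.2
    obtain ⟨T', a, hT', h1, h2⟩ := (intersects_iff _ _).1 h.1
    refine ⟨pullback (terminal.from T) (terminal.from T'),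
      isRegularEpi_terminal_from_comp (pullback.fst _ _) inferInstance hT, ?_⟩
    rw [List.forall_mem_cons]
    refine ⟨⟨pullback.snd _ _ ≫ a, Subobject.factors_of_factors_right _ h1,
      Subobject.factors_of_factors_right _ h2⟩, fun W hW => ?_⟩
    obtain ⟨w, h3, h4⟩ := hl W hW
    exact ⟨pullback.fst _ _ ≫ w, Subobject.factors_of_factors_right _ h3,
      Subobject.factors_of_factors_right _ h4⟩

/-- Partial application of a realizer of a term to parameters in `A'`. -/
theorem exists_partial_app {n : ℕ} {t : CombTerm n} {T : C} {β : T ⟶ P.A.carrier}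
    (hβ : (P.realizer t).Factors β) (hβ' : P.sub.Factors β) (ps : List (T ⟶ P.A.carrier))
    (hps : ∀ p ∈ ps, P.sub.Factors p) (hlen : ps.length < n) :
    ∃ d : T ⟶ P.A.carrier, P.sub.Factors d ∧ ∀ ⦃S : C⦄ (s : S ⟶ T) (xs : List (S ⟶ P.A.carrier))
      (ρ : Fin n → (S ⟶ P.A.carrier)), List.ofFn ρ = ps.map (s ≫ ·) ++ xs →
      (∀ i < xs.length, ∃ y, P.A.AppList (s ≫ d) (xs.take i) y) ∧
        ∀ z, P.A.Eval ρ t z → ∃ y, P.A.Le y z ∧ P.A.AppList (s ≫ d) xs y := by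
  obtain ⟨d, hd⟩ : ∃ d, P.A.AppList β ps d := by
    -- The tuple is padded with `β`. Fewer than `n` applications are always defined, so the padding
    -- is never used.
    obtain ⟨d, hd⟩ := (realizer_spec hβ (𝟙 T)
      (fun i : Fin n => if h : i < ps.length then ps[i] else β)).1 _ hlen
    refine ⟨d, ?_⟩
    rw [Category.id_comp] at hd
    convert hd using 1
    apply List.ext_getElem
    · simp [hlen.le]
    · intro i h1 h2
      simp [h1]
  refine ⟨d, appList_mem_sub hβ' hps hd, fun S s xs ρ hρ => ?_⟩
  have hlen' : n = ps.length + xs.length := by simpa using congrArg List.length hρ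
  have hd' := hd.precomp s
  obtain ⟨h1, h2⟩ := realizer_spec hβ s ρ
  constructor
  · intro i hi
    obtain ⟨y, hy⟩ := h1 (ps.length + i) (by omega)
    rw [hρ, ← List.length_map (as := ps) (s ≫ ·), List.take_length_add_append,
      OPAS.appList_append] at hy
    obtain ⟨b, h3, h4⟩ := hy
    obtain rfl := OPAS.AppList.unique h3 hd'
    exact ⟨y, h4⟩
  · intro z hz
    obtain ⟨y, hl, hy⟩ := h2 z hz
    rw [hρ, OPAS.appList_append] at hy
    obtain ⟨b, h3, h4⟩ := hy
    obtain rfl := OPAS.AppList.unique h3 hd'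
    exact ⟨y, hl, h4⟩

theorem exists_tracker {n : ℕ} {t : CombTerm n} {T : C} {β : T ⟶ P.A.carrier}
    (hβ : (P.realizer t).Factors β) (hβ' : P.sub.Factors β) (ps : List (T ⟶ P.A.carrier))
    (hps : ∀ p ∈ ps, P.sub.Factors p) (hlen : ps.length < n) :
    ∃ d : T ⟶ P.A.carrier, P.sub.Factors d ∧ ∀ ⦃S : C⦄ (s : S ⟶ T) (b : S ⟶ P.A.carrier)
      (ρ : Fin n → (S ⟶ P.A.carrier)), List.ofFn ρ = ps.map (s ≫ ·) ++ [b] →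
        ∀ z, P.A.Eval ρ t z → ∃ y, P.A.App (s ≫ d) b y ∧ P.A.Le y z := by
  obtain ⟨d, hd, h⟩ := exists_partial_app hβ hβ' ps hps hlen
  refine ⟨d, hd, fun S s b ρ hρ z hz => ?_⟩
  obtain ⟨y, hl, c, hc, rfl⟩ := (h s [b] ρ hρ).2 z hz
  exact ⟨c, hc, hl⟩

/-- The value `c` on the first argument exists before any second argument is given; this uniformity
is what currying needs. -/
theorem exists_tracker₂ {n : ℕ} {t : CombTerm n} {T : C} {β : T ⟶ P.A.carrier}
    (hβ : (P.realizer t).Factors β) (hβ' : P.sub.Factors β) (ps : List (T ⟶ P.A.carrier))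
    (hps : ∀ p ∈ ps, P.sub.Factors p) (hlen : ps.length + 2 = n) :
    ∃ d : T ⟶ P.A.carrier, P.sub.Factors d ∧ ∀ ⦃S : C⦄ (s : S ⟶ T) (b : S ⟶ P.A.carrier),
      ∃ c, P.A.App (s ≫ d) b c ∧ ∀ ⦃S' : C⦄ (s' : S' ⟶ S) (x : S' ⟶ P.A.carrier)
        (ρ : Fin n → (S' ⟶ P.A.carrier)), List.ofFn ρ = ps.map ((s' ≫ s) ≫ ·) ++ [s' ≫ b, x] →
        ∀ z, P.A.Eval ρ t z → ∃ y, P.A.App (s' ≫ c) x y ∧ P.A.Le y z := by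
  obtain ⟨d, hd, h⟩ := exists_partial_app hβ hβ' ps hps (by omega)
  refine ⟨d, hd, fun S s b => ?_⟩
  subst hlen
  -- The second `b` is a dummy: only the first application is used.
  obtain ⟨c', c, hc, rfl⟩ := (h s [b, b]
    (fun i => (ps.map (s ≫ ·) ++ [b, b])[i]'(by simp)) (by
      apply List.ext_getElem
      · simp
      · intro i h1 h2
        rw [List.getElem_ofFn]
        rfl)).1 1 (by simp)
  refine ⟨c, hc, fun S' s' x ρ hρ z hz => ?_⟩
  obtain ⟨y, hl, c', hc', y', hy, rfl⟩ := (h (s' ≫ s) [s' ≫ b, x] ρ hρ).2 z hz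
  rw [Category.assoc] at hc'
  obtain rfl := PartialArrow.Val.unique hc' (hc.precomp s')
  exact ⟨y', hy, hl⟩

end OPCAPair

theorem lift_comp_fst_snd {C : Type u} [Category.{v} C] {T X Y : C} [HasBinaryProduct X Y]
    (w : T ⟶ X ⨯ Y) : prod.lift (w ≫ prod.fst) (w ≫ prod.snd) = w := by
  rw [← prod.comp_lift, prod.lift_fst_snd, Category.comp_id]

/-! ### Realizability predicates -/

section Preds

variable {C : Type u} [Category.{v} C] [HeytingCategory C]

/-- A realizability predicate on `X`: a subobject of `A × X` that is downward closed in `A`. -/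
structure RPred (P : OPCAPair C) (X : C) where
  rel : Subobject (P.A.carrier ⨯ X)
  down' {T : C} (a b : T ⟶ P.A.carrier) (x : T ⟶ X) :
    rel.Factors (prod.lift a x) → P.A.Le b a → rel.Factors (prod.lift b x)

namespace RPred

variable {P : OPCAPair C} {W X Z : C}

/-- `a` realizes `Y(x)`. -/
def Mem (Y : RPred P X) {T : C} (a : T ⟶ P.A.carrier) (x : T ⟶ X) : Prop :=
  Y.rel.Factors (prod.lift a x)

theorem Mem.down {Y : RPred P X} {T : C} {a b : T ⟶ P.A.carrier} {x : T ⟶ X} (h : Y.Mem a x)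
    (hl : P.A.Le b a) : Y.Mem b x :=
  Y.down' a b x h hl

theorem Mem.precomp {Y : RPred P X} {T S : C} {a : T ⟶ P.A.carrier} {x : T ⟶ X} (h : Y.Mem a x)
    (s : S ⟶ T) : Y.Mem (s ≫ a) (s ≫ x) := by
  rw [Mem, ← prod.comp_lift]
  exact Subobject.factors_of_factors_right s h

/-- The elements of `G` at which an application is defined and realizes `Y`. -/
theorem exists_appMem {G : C} (α β : G ⟶ P.A.carrier) (ω : G ⟶ X) (Y : RPred P X) :
    ∃ U : Subobject G, ∀ {T : C} (y : T ⟶ G), U.Factors y ↔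
      ∃ d, P.A.App (y ≫ α) (y ≫ β) d ∧ Y.Mem d (y ≫ ω) := by
  let q : PartialArrow G (Y.rel : C) :=
    ((P.A.mul (PartialArrow.ofHom α) (PartialArrow.ofHom β)).pair (PartialArrow.ofHom ω)).comp
      ⟨Y.rel, 𝟙 _⟩
  refine ⟨q.dom, fun {T} y => ?_⟩
  rw [q.factors_iff_exists_val]
  simp only [q, PartialArrow.comp_val, PartialArrow.pair_val, OPAS.mul_val, PartialArrow.ofHom_val]
  constructor
  · rintro ⟨z, w, ⟨⟨a, b, rfl, rfl, h⟩, h'⟩, hw, _⟩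
    refine ⟨w ≫ prod.fst, h, ?_⟩
    rw [Mem, h']
    rwa [lift_comp_fst_snd]
  · rintro ⟨d, h, hd⟩
    exact ⟨_, prod.lift d (y ≫ ω), ⟨⟨_, _, rfl, rfl, by rwa [prod.lift_fst]⟩,
      by rw [prod.lift_snd]⟩, hd, rfl⟩

/-- The condition cuts out a subobject, since values of application are unique, and membership in a
subobject is local for covers. -/
theorem appMem_of_cover {Y : RPred P X} {T S : C} {a b : T ⟶ P.A.carrier} {x : T ⟶ X} (e : S ⟶ T)
    [StrongEpi e] (h : ∃ d, P.A.App (e ≫ a) (e ≫ b) d ∧ Y.Mem d (e ≫ x)) :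
    ∃ d, P.A.App a b d ∧ Y.Mem d x := by
  obtain ⟨U, hU⟩ := exists_appMem a b x Y
  have := (hU (𝟙 T)).1 (factors_of_cover U e _ (by rw [Category.comp_id]; exact (hU e).2 h))
  simpa only [Category.id_comp] using this

/-- Entailment of realizability predicates. -/
instance : LE (RPred P X) where
  le Y Y' := ∃ V : Subobject P.A.carrier, Intersects V P.sub ∧
    ∀ ⦃T : C⦄ (a b : T ⟶ P.A.carrier) (x : T ⟶ X), V.Factors a → Y.Mem b x →
      ∃ c : T ⟶ P.A.carrier, P.A.App a b c ∧ Y'.Mem c x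

/-- The image of `d` serves as tracking subobject: its elements lift to `T` after a cover, and the
conclusion descends by `appMem_of_cover`. -/
theorem le_of_stage {Y Y' : RPred P X} {T : C} (hT : IsRegularEpi (terminal.from T))
    (d : T ⟶ P.A.carrier) (hd : P.sub.Factors d)
    (h : ∀ ⦃S : C⦄ (s : S ⟶ T) (b : S ⟶ P.A.carrier) (x : S ⟶ X), Y.Mem b x →
      ∃ c, P.A.App (s ≫ d) b c ∧ Y'.Mem c x) : Y ≤ Y' := by
  obtain ⟨I, hI⟩ := exists_image_mem d
  refine ⟨I, (intersects_iff _ _).2 ⟨T, d, hT, (hI d).2 ⟨T, 𝟙 T, 𝟙 T,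
    (isRegularEpi_iff_strongEpi _).2 inferInstance, rfl⟩, hd⟩, ?_⟩
  intro S a b x ha hb
  obtain ⟨R, e, y, he, hy⟩ := (hI a).1 ha
  refine appMem_of_cover e ?_
  rw [← hy]
  exact h y _ _ (hb.precomp e)

/-! #### Terms used as realizers -/

variable (P) in
/-- The elements that represent the first projection. -/
noncomputable abbrev proj₁ : Subobject P.A.carrier := P.realizer (n := 2) (.var 0)

variable (P) in
/-- The elements that represent the second projection. -/
noncomputable abbrev proj₂ : Subobject P.A.carrier := P.realizer (n := 2) (.var 1)

variable (P) in
/-- The elements that represent `(x, y, z) ↦ zxy`. -/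
noncomputable abbrev pairing : Subobject P.A.carrier :=
  P.realizer (n := 3) (.app (.app (.var 2) (.var 0)) (.var 1))

theorem proj₁_spec {T : C} {k : T ⟶ P.A.carrier} (hk : (proj₁ P).Factors k)
    (u v : T ⟶ P.A.carrier) : ∃ w y, P.A.App k u w ∧ P.A.App w v y ∧ P.A.Le y u := by
  obtain ⟨y, hl, w, h1, _, h2, rfl⟩ := (OPCAPair.realizer_spec hk (𝟙 T) ![u, v]).2 u rfl
  rw [Category.id_comp] at h1
  exact ⟨w, _, h1, h2, hl⟩

theorem proj₂_spec {T : C} {k : T ⟶ P.A.carrier} (hk : (proj₂ P).Factors k)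
    (u v : T ⟶ P.A.carrier) : ∃ w y, P.A.App k u w ∧ P.A.App w v y ∧ P.A.Le y v := by
  obtain ⟨y, hl, w, h1, _, h2, rfl⟩ := (OPCAPair.realizer_spec hk (𝟙 T) ![u, v]).2 v rfl
  rw [Category.id_comp] at h1
  exact ⟨w, _, h1, h2, hl⟩

/-- Monotonicity of application passes definedness and upper bounds down through iterated
application. The constant predicates `const` depend on this. -/
theorem realizer_down {n : ℕ} (t : CombTerm n) {T : C} {a b : T ⟶ P.A.carrier}
    (ha : (P.realizer t).Factors a) (h : P.A.Le b a) : (P.realizer t).Factors b := by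
  have key : ∀ {S : C} (xs : List (S ⟶ P.A.carrier)) (a b y : S ⟶ P.A.carrier), P.A.Le b a →
      P.A.AppList a xs y → ∃ z, P.A.Le z y ∧ P.A.AppList b xs z := by
    intro S xs
    induction xs with
    | nil => exact fun a b y h e => ⟨b, e ▸ h, rfl⟩
    | cons x xs ih =>
      rintro a b y h ⟨c, h1, h2⟩
      obtain ⟨d, h3, h4⟩ := P.A.app_mono _ _ _ _ _ h (P.A.le_refl x) h1
      obtain ⟨z, h5, h6⟩ := ih c d y h4 h2
      exact ⟨z, h5, d, h3, h6⟩
  rw [OPCAPair.realizer, OPAS.mem_realizers] at ha ⊢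
  intro S s x
  obtain ⟨h1, h2⟩ := ha s x
  refine ⟨fun i hi => ?_, fun z hz => ?_⟩
  · obtain ⟨y, hy⟩ := h1 i hi
    obtain ⟨z, _, hz⟩ := key _ _ _ _ (h.precomp s) hy
    exact ⟨z, hz⟩
  · obtain ⟨y, hl, hy⟩ := h2 z hz
    obtain ⟨w, hw, hw'⟩ := key _ _ _ _ (h.precomp s) hy
    exact ⟨w, P.A.le_trans _ _ _ hw hl, hw'⟩

/-! #### The logical operations -/

/-- Reindexing. -/
noncomputable def pull (f : X ⟶ Z) (Y : RPred P Z) : RPred P X where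
  rel := (Subobject.pullback (prod.map (𝟙 _) f)).obj Y.rel
  down' a b x h hl := by
    rw [factors_pullback_iff, prod.lift_map, Category.comp_id] at h ⊢
    exact Y.down' _ _ _ h hl

@[simp]
theorem mem_pull (f : X ⟶ Z) (Y : RPred P Z) {T : C} (a : T ⟶ P.A.carrier) (x : T ⟶ X) :
    (Y.pull f).Mem a x ↔ Y.Mem a (x ≫ f) := by
  rw [Mem, pull, factors_pullback_iff, prod.lift_map, Category.comp_id, Mem]

noncomputable instance : Top (RPred P X) where
  top := ⟨⊤, fun _ _ _ _ _ => Subobject.top_factors _⟩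

theorem mem_top {T : C} (a : T ⟶ P.A.carrier) (x : T ⟶ X) : (⊤ : RPred P X).Mem a x :=
  Subobject.top_factors _

/-- Universal quantification along `A × D ⟶ A × Z` of the condition that the application is defined
and realizes `Y`. One construction covers implication (`f` the identity), bounded quantification
and, with `D` a set of projections, conjunction; so `D` is just a subobject. -/
theorem exists_allImp (f : X ⟶ Z) (D : Subobject (P.A.carrier ⨯ X)) (Y : RPred P X) :
    ∃ Y' : RPred P Z, ∀ {T : C} (c : T ⟶ P.A.carrier) (z : T ⟶ Z), Y'.Mem c z ↔
      ∀ ⦃S : C⦄ (s : S ⟶ T) (b : S ⟶ P.A.carrier) (x : S ⟶ X), x ≫ f = s ≫ z →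
        D.Factors (prod.lift b x) → ∃ d, P.A.App (s ≫ c) b d ∧ Y.Mem d x := by
  obtain ⟨U, hU⟩ := exists_appMem (G := P.A.carrier ⨯ (D : C)) prod.fst
    (prod.snd ≫ D.arrow ≫ prod.fst) (prod.snd ≫ D.arrow ≫ prod.snd) Y
  obtain ⟨R, hR⟩ := exists_forall (prod.map (𝟙 P.A.carrier) (D.arrow ≫ prod.snd ≫ f)) U
  have key : ∀ {T : C} (c : T ⟶ P.A.carrier) (z : T ⟶ Z), R.Factors (prod.lift c z) ↔
      ∀ ⦃S : C⦄ (s : S ⟶ T) (b : S ⟶ P.A.carrier) (x : S ⟶ X), x ≫ f = s ≫ z →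
        D.Factors (prod.lift b x) → ∃ d, P.A.App (s ≫ c) b d ∧ Y.Mem d x := by
    intro T c z
    rw [hR]
    constructor
    · intro h S s b x hx hb
      have := (hU _).1 (h s (prod.lift (s ≫ c) (D.factorThru _ hb)) (by
        rw [prod.lift_map, prod.comp_lift, Subobject.factorThru_arrow_assoc, prod.lift_snd_assoc,
          hx, Category.comp_id]))
      simpa only [prod.lift_fst, prod.lift_snd, prod.lift_snd_assoc,
        Subobject.factorThru_arrow_assoc] using this
    · intro h S s y hy
      rw [prod.comp_lift] at hy
      have h1 := congrArg (· ≫ prod.fst) hy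
      have h2 := congrArg (· ≫ prod.snd) hy
      simp only [prod.lift_fst, prod.lift_snd, Category.assoc, prod.map_fst, prod.map_snd,
        Category.comp_id] at h1 h2
      rw [hU, h1]
      refine h s _ _ (by simpa only [Category.assoc] using h2) ?_
      have := Subobject.factors_comp_arrow (P := D) (y ≫ prod.snd)
      rw [← lift_comp_fst_snd ((y ≫ prod.snd) ≫ D.arrow)] at this
      simpa only [Category.assoc] using this
  refine ⟨⟨R, fun a b x ha hl => ?_⟩, key⟩
  rw [key] at ha ⊢
  intro S s c w hw hc
  obtain ⟨d, h1, h2⟩ := ha s c w hw hc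
  obtain ⟨d', h3, h4⟩ := P.A.app_mono _ _ _ _ _ (hl.precomp s) (P.A.le_refl c) h1
  exact ⟨d', h3, h2.down h4⟩

/-- The predicate `z ↦ {c | ∀ x ∈ f⁻¹(z), ∀ b, D(b, x) → cb ∈ Y(x)}`. -/
noncomputable def allImp (f : X ⟶ Z) (D : Subobject (P.A.carrier ⨯ X)) (Y : RPred P X) : RPred P Z :=
  Classical.choose (exists_allImp f D Y)

theorem mem_allImp (f : X ⟶ Z) (D : Subobject (P.A.carrier ⨯ X)) (Y : RPred P X) {T : C}
    (c : T ⟶ P.A.carrier) (z : T ⟶ Z) : (allImp f D Y).Mem c z ↔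
      ∀ ⦃S : C⦄ (s : S ⟶ T) (b : S ⟶ P.A.carrier) (x : S ⟶ X), x ≫ f = s ≫ z →
        D.Factors (prod.lift b x) → ∃ d, P.A.App (s ≫ c) b d ∧ Y.Mem d x :=
  Classical.choose_spec (exists_allImp f D Y) c z

/-- Conjunction: the realizers code pairs. -/
noncomputable instance : Min (RPred P X) where
  min Y Y' :=
    let Y₁ := allImp (𝟙 X) ((Subobject.pullback prod.fst).obj (proj₁ P)) Y
    let Y₂ := allImp (𝟙 X) ((Subobject.pullback prod.fst).obj (proj₂ P)) Y'
    ⟨Y₁.rel ⊓ Y₂.rel, fun a b x h hl => (Subobject.inf_factors _).2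
      ⟨Y₁.down' a b x ((Subobject.inf_factors _).1 h).1 hl,
        Y₂.down' a b x ((Subobject.inf_factors _).1 h).2 hl⟩⟩

/-- Projections need not exist as global elements, so a pair is tested against all representatives
of each projection. -/
theorem mem_inf (Y Y' : RPred P X) {T : C} (c : T ⟶ P.A.carrier) (x : T ⟶ X) :
    (Y ⊓ Y').Mem c x ↔
      (∀ ⦃S : C⦄ (s : S ⟶ T) (k : S ⟶ P.A.carrier), (proj₁ P).Factors k →
        ∃ d, P.A.App (s ≫ c) k d ∧ Y.Mem d (s ≫ x)) ∧
      (∀ ⦃S : C⦄ (s : S ⟶ T) (k : S ⟶ P.A.carrier), (proj₂ P).Factors k →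
        ∃ d, P.A.App (s ≫ c) k d ∧ Y'.Mem d (s ≫ x)) := by
  have key : ∀ (V : Subobject P.A.carrier) (Y : RPred P X),
      (allImp (𝟙 X) ((Subobject.pullback prod.fst).obj V) Y).Mem c x ↔
      ∀ ⦃S : C⦄ (s : S ⟶ T) (k : S ⟶ P.A.carrier), V.Factors k →
        ∃ d, P.A.App (s ≫ c) k d ∧ Y.Mem d (s ≫ x) := by
    intro V Y
    simp only [mem_allImp, factors_pullback_iff, prod.lift_fst, Category.comp_id]
    exact ⟨fun h S s k hk => h s k _ rfl hk, fun h S s k y e hk => e ▸ h s k hk⟩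
  rw [← key, ← key]
  exact Subobject.inf_factors _

/-- The predicate with constant value the realizers of a term. -/
noncomputable def const {n : ℕ} (t : CombTerm n) (X : C) : RPred P X where
  rel := (Subobject.pullback prod.fst).obj (P.realizer t)
  down' a b x h hl := by
    rw [factors_pullback_iff, prod.lift_fst] at h ⊢
    exact realizer_down t h hl

theorem mem_const {n : ℕ} (t : CombTerm n) {T : C} (a : T ⟶ P.A.carrier) (x : T ⟶ X) :
    (const t X).Mem a x ↔ (P.realizer t).Factors a := by
  rw [Mem, const, factors_pullback_iff, prod.lift_fst]

/-- The image of `Y` under `1 × f`. Realizers stay the same; only the witness `x` has to be found on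
a cover. -/
theorem exists_ex (f : X ⟶ Z) (Y : RPred P X) :
    ∃ Y' : RPred P Z, ∀ {T : C} (c : T ⟶ P.A.carrier) (z : T ⟶ Z), Y'.Mem c z ↔
      ∃ (S : C) (e : S ⟶ T) (x : S ⟶ X), IsRegularEpi e ∧ x ≫ f = e ≫ z ∧ Y.Mem (e ≫ c) x := by
  obtain ⟨I, hI⟩ := exists_image_mem (Y.rel.arrow ≫ prod.map (𝟙 _) f)
  have key : ∀ {T : C} (c : T ⟶ P.A.carrier) (z : T ⟶ Z), I.Factors (prod.lift c z) ↔
      ∃ (S : C) (e : S ⟶ T) (x : S ⟶ X), IsRegularEpi e ∧ x ≫ f = e ≫ z ∧ Y.Mem (e ≫ c) x := by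
    intro T c z
    rw [hI]
    constructor
    · rintro ⟨S, e, y, he, h⟩
      rw [prod.comp_lift] at h
      have h1 := congrArg (· ≫ prod.fst) h
      have h2 := congrArg (· ≫ prod.snd) h
      simp only [prod.lift_fst, prod.lift_snd, Category.assoc, prod.map_fst, prod.map_snd,
        Category.comp_id] at h1 h2
      refine ⟨S, e, y ≫ Y.rel.arrow ≫ prod.snd, he, by simpa using h2, ?_⟩
      rw [Mem, ← h1]
      rw [← Category.assoc, ← Category.assoc, lift_comp_fst_snd]
      exact Subobject.factors_comp_arrow y
    · rintro ⟨S, e, x, he, h, hm⟩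
      rw [Mem] at hm
      refine ⟨S, e, Y.rel.factorThru _ hm, he, ?_⟩
      rw [Subobject.factorThru_arrow_assoc, prod.lift_map, prod.comp_lift, h, Category.comp_id]
  refine ⟨⟨I, fun a b x h hl => ?_⟩, key⟩
  rw [key] at h ⊢
  obtain ⟨S, e, x, he, h, hm⟩ := h
  exact ⟨S, e, x, he, h, hm.down (hl.precomp e)⟩

/-- Existential quantification along `f`. -/
noncomputable def ex (f : X ⟶ Z) (Y : RPred P X) : RPred P Z :=
  Classical.choose (exists_ex f Y)

theorem mem_ex (f : X ⟶ Z) (Y : RPred P X) {T : C} (c : T ⟶ P.A.carrier) (z : T ⟶ Z) :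
    (ex f Y).Mem c z ↔
      ∃ (S : C) (e : S ⟶ T) (x : S ⟶ X), IsRegularEpi e ∧ x ≫ f = e ≫ z ∧ Y.Mem (e ≫ c) x :=
  Classical.choose_spec (exists_ex f Y) c z

/-- The elements that have a realizer. -/
noncomputable def supp (Y : RPred P X) : Subobject X :=
  Classical.choose (exists_image_mem (Y.rel.arrow ≫ prod.snd))

theorem mem_supp (Y : RPred P X) {T : C} (x : T ⟶ X) : Y.supp.Factors x ↔
    ∃ (S : C) (e : S ⟶ T) (a : S ⟶ P.A.carrier), IsRegularEpi e ∧ Y.Mem a (e ≫ x) := by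
  rw [supp, Classical.choose_spec (exists_image_mem (Y.rel.arrow ≫ prod.snd)) x]
  constructor
  · rintro ⟨S, e, y, he, h⟩
    refine ⟨S, e, y ≫ Y.rel.arrow ≫ prod.fst, he, ?_⟩
    rw [Mem, ← h]
    rw [← Category.assoc, ← Category.assoc, lift_comp_fst_snd]
    exact Subobject.factors_comp_arrow y
  · rintro ⟨S, e, a, he, h⟩
    rw [Mem] at h
    exact ⟨S, e, Y.rel.factorThru _ h, he, by
      rw [Subobject.factorThru_arrow_assoc, prod.lift_snd]⟩

/-- A plain union of relations, in which a realizer does not reveal its disjunct; the tags enter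
only in the `Max` instance. -/
theorem exists_disj (Y Y' : RPred P X) :
    ∃ Z : RPred P X, Y.rel ≤ Z.rel ∧ Y'.rel ≤ Z.rel ∧
      ∀ {T : C} (a : T ⟶ P.A.carrier) (x : T ⟶ X) (R : Subobject T), Z.Mem a x →
      (∀ ⦃S : C⦄ (s : S ⟶ T), Y.Mem (s ≫ a) (s ≫ x) → R.Factors s) →
      (∀ ⦃S : C⦄ (s : S ⟶ T), Y'.Mem (s ≫ a) (s ≫ x) → R.Factors s) → R.Factors (𝟙 T) := by
  obtain ⟨W, h1, h2, h3⟩ := exists_sup Y.rel Y'.rel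
  refine ⟨⟨W, fun {T} a b x h hl => ?_⟩, h1, h2, fun {T} a x R h hY hY' => h3 _ R h ?_ ?_⟩
  -- Downward closure passes to the union by case analysis towards the subobject of `T` where `b`
  -- belongs to `W`.
  · have key : ∀ Y'' : RPred P X, Y''.rel ≤ W → ∀ ⦃S : C⦄ (s : S ⟶ T),
        Y''.rel.Factors (s ≫ prod.lift a x) →
          ((Subobject.pullback (prod.lift b x)).obj W).Factors s := by
      intro Y'' hW S s hs
      rw [factors_pullback_iff]
      rw [prod.comp_lift] at hs ⊢
      exact Subobject.factors_of_le _ hW (Y''.down' _ _ _ hs (hl.precomp s))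
    have := h3 _ ((Subobject.pullback (prod.lift b x)).obj W) h (key Y h1) (key Y' h2)
    rwa [factors_pullback_iff, Category.id_comp] at this
  · intro S s hs
    rw [prod.comp_lift] at hs
    exact hY s hs
  · intro S s hs
    rw [prod.comp_lift] at hs
    exact hY' s hs

end RPred

end Preds

/-! ### Entailment of predicates: adjunctions, Beck–Chevalley, Frobenius -/

section Entailment

variable {C : Type u} [Category.{v} C] [HeytingCategory C] {P : OPCAPair C} {W X Z : C}

namespace RPred

/-- The realizers are the identity and composition combinators. They reach the intended value only
up to `≤`, and downward closure closes the gap; the same happens in all later realizer computations.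
-/
instance : Preorder (RPred P X) where
  le_refl Y := by
    obtain ⟨T, hT, h⟩ := P.exists_common_stage [P.realizer (n := 1) (.var 0)]
      (by simp [P.intersects_realizer])
    obtain ⟨β, hβ, hβ'⟩ := h _ (List.mem_singleton_self _)
    obtain ⟨d, hd, h⟩ := OPCAPair.exists_tracker hβ hβ' [] (by simp) (by simp)
    refine le_of_stage hT d hd fun S s b x hx => ?_
    obtain ⟨y, hy, hl⟩ := h s b ![b] rfl b rfl
    exact ⟨y, hy, hx.down hl⟩
  le_trans Y₁ Y₂ Y₃ := by
    rintro ⟨V, hV, tV⟩ ⟨U, hU, tU⟩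
    obtain ⟨T, hT, h⟩ := P.exists_common_stage
      [V, U, P.realizer (n := 3) (.app (.var 0) (.app (.var 1) (.var 2)))]
      (by simp [P.intersects_realizer, hV, hU])
    simp only [List.forall_mem_cons] at h
    obtain ⟨⟨a, ha, ha'⟩, ⟨c, hc, hc'⟩, ⟨β, hβ, hβ'⟩, -⟩ := h
    obtain ⟨d, hd, h⟩ := OPCAPair.exists_tracker hβ hβ' [c, a] (by simp [ha', hc']) (by simp)
    refine le_of_stage hT d hd fun S s b x hx => ?_
    obtain ⟨y, hy, hy'⟩ := tV (s ≫ a) b x (Subobject.factors_of_factors_right s ha) hx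
    obtain ⟨z, hz, hz'⟩ := tU (s ≫ c) y x (Subobject.factors_of_factors_right s hc) hy'
    obtain ⟨w, hw, hl⟩ := h s b ![s ≫ c, s ≫ a, b] rfl z ⟨_, _, rfl, ⟨_, _, rfl, rfl, hy⟩, hz⟩
    exact ⟨w, hw, hz'.down hl⟩

theorem pull_mono (f : X ⟶ Z) {Y Y' : RPred P Z} (h : Y ≤ Y') : Y.pull f ≤ Y'.pull f := by
  obtain ⟨V, hV, tV⟩ := h
  refine ⟨V, hV, fun T a b x ha hb => ?_⟩
  simp only [mem_pull] at hb ⊢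
  exact tV a b _ ha hb

/-- Predicates with the same realizers are equivalent. -/
theorem le_of_mem {Y Y' : RPred P X}
    (h : ∀ ⦃T : C⦄ (a : T ⟶ P.A.carrier) (x : T ⟶ X), Y.Mem a x → Y'.Mem a x) : Y ≤ Y' := by
  obtain ⟨V, hV, tV⟩ := le_refl Y
  refine ⟨V, hV, fun T a b x ha hb => ?_⟩
  obtain ⟨c, h1, h2⟩ := tV a b x ha hb
  exact ⟨c, h1, h c x h2⟩

theorem pull_comp_le (f : W ⟶ X) (g : X ⟶ Z) (Y : RPred P Z) :
    Y.pull (f ≫ g) ≤ (Y.pull g).pull f :=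
  le_of_mem fun T a x h => by simpa only [mem_pull, Category.assoc] using h

theorem le_pull_comp (f : W ⟶ X) (g : X ⟶ Z) (Y : RPred P Z) :
    (Y.pull g).pull f ≤ Y.pull (f ≫ g) :=
  le_of_mem fun T a x h => by simpa only [mem_pull, Category.assoc] using h

theorem inf_le_left (Y Y' : RPred P X) : Y ⊓ Y' ≤ Y := by
  -- The realizer is `b ↦ b k`, with `k` in `A'` a first projection.
  obtain ⟨T, hT, h⟩ := P.exists_common_stage
    [proj₁ P, P.realizer (n := 2) (.app (.var 1) (.var 0))] (by simp [P.intersects_realizer])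
  simp only [List.forall_mem_cons] at h
  obtain ⟨⟨k, hk, hk'⟩, ⟨β, hβ, hβ'⟩, -⟩ := h
  obtain ⟨d, hd, h⟩ := OPCAPair.exists_tracker hβ hβ' [k] (by simp [hk']) (by simp)
  refine le_of_stage hT d hd fun S s b x hx => ?_
  obtain ⟨y, hy, hy'⟩ := ((mem_inf _ _ _ _).1 hx).1 (𝟙 S) (s ≫ k)
    (Subobject.factors_of_factors_right s hk)
  rw [Category.id_comp] at hy hy'
  obtain ⟨w, hw, hl⟩ := h s b ![s ≫ k, b] rfl y ⟨_, _, rfl, rfl, hy⟩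
  exact ⟨w, hw, hy'.down hl⟩

theorem inf_le_right (Y Y' : RPred P X) : Y ⊓ Y' ≤ Y' := by
  obtain ⟨T, hT, h⟩ := P.exists_common_stage
    [proj₂ P, P.realizer (n := 2) (.app (.var 1) (.var 0))] (by simp [P.intersects_realizer])
  simp only [List.forall_mem_cons] at h
  obtain ⟨⟨k, hk, hk'⟩, ⟨β, hβ, hβ'⟩, -⟩ := h
  obtain ⟨d, hd, h⟩ := OPCAPair.exists_tracker hβ hβ' [k] (by simp [hk']) (by simp)
  refine le_of_stage hT d hd fun S s b x hx => ?_
  obtain ⟨y, hy, hy'⟩ := ((mem_inf _ _ _ _).1 hx).2 (𝟙 S) (s ≫ k)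
    (Subobject.factors_of_factors_right s hk)
  rw [Category.id_comp] at hy hy'
  obtain ⟨w, hw, hl⟩ := h s b ![s ≫ k, b] rfl y ⟨_, _, rfl, rfl, hy⟩
  exact ⟨w, hw, hy'.down hl⟩

/-- The term `z ↦ z a b` takes three arguments, so `p a b` is always defined, and applying it to a
projection returns a component up to `≤`. -/
theorem exists_mem_inf {T : C} {p : T ⟶ P.A.carrier} (hp : (pairing P).Factors p)
    {Y Y' : RPred P X} {a b : T ⟶ P.A.carrier} {x : T ⟶ X} (ha : Y.Mem a x) (hb : Y'.Mem b x) :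
    ∃ u c, P.A.App p a u ∧ P.A.App u b c ∧ (Y ⊓ Y').Mem c x := by
  -- The last `b` is a dummy third argument.
  obtain ⟨_, u, hu, c, hc, rfl⟩ := (OPCAPair.realizer_spec hp (𝟙 T) ![a, b, b]).1 2 (by norm_num)
  rw [Category.id_comp] at hu
  have key : ∀ ⦃S : C⦄ (s : S ⟶ T) (k z w y : S ⟶ P.A.carrier), P.A.App k (s ≫ a) w →
      P.A.App w (s ≫ b) y → P.A.Le y z → ∃ d, P.A.App (s ≫ c) k d ∧ P.A.Le d z := by
    intro S s k z w y h1 h2 hl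
    obtain ⟨_, hl', u', hu', c', hc', d, hd, rfl⟩ :=
      (OPCAPair.realizer_spec hp s ![s ≫ a, s ≫ b, k]).2 y
        ⟨_, _, ⟨_, _, rfl, rfl, h1⟩, rfl, h2⟩
    obtain rfl := PartialArrow.Val.unique hu' (hu.precomp s)
    obtain rfl := PartialArrow.Val.unique hc' (hc.precomp s)
    exact ⟨d, hd, P.A.le_trans _ _ _ hl' hl⟩
  refine ⟨u, c, hu, hc, (mem_inf _ _ _ _).2 ⟨fun S s k hk => ?_, fun S s k hk => ?_⟩⟩
  · obtain ⟨w, y, h1, h2, hl⟩ := proj₁_spec hk (s ≫ a) (s ≫ b)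
    obtain ⟨d, hd, hl⟩ := key s k _ w y h1 h2 hl
    exact ⟨d, hd, (ha.precomp s).down hl⟩
  · obtain ⟨w, y, h1, h2, hl⟩ := proj₂_spec hk (s ≫ a) (s ≫ b)
    obtain ⟨d, hd, hl⟩ := key s k _ w y h1 h2 hl
    exact ⟨d, hd, (hb.precomp s).down hl⟩

theorem le_inf {Z Y Y' : RPred P X} (h : Z ≤ Y) (h' : Z ≤ Y') : Z ≤ Y ⊓ Y' := by
  obtain ⟨V, hV, tV⟩ := h
  obtain ⟨U, hU, tU⟩ := h'
  -- The realizer is `b ↦ p (a b) (c b)`.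
  obtain ⟨T, hT, h⟩ := P.exists_common_stage [V, U, pairing P,
    P.realizer (n := 4) (.app (.app (.var 0) (.app (.var 1) (.var 3))) (.app (.var 2) (.var 3)))]
    (by simp [P.intersects_realizer, hV, hU])
  simp only [List.forall_mem_cons] at h
  obtain ⟨⟨a, ha, ha'⟩, ⟨c, hc, hc'⟩, ⟨p, hp, hp'⟩, ⟨β, hβ, hβ'⟩, -⟩ := h
  obtain ⟨d, hd, h⟩ := OPCAPair.exists_tracker hβ hβ' [p, a, c] (by simp [ha', hc', hp'])
    (by simp)
  refine le_of_stage hT d hd fun S s b x hx => ?_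
  obtain ⟨y, hy, hy'⟩ := tV (s ≫ a) b x (Subobject.factors_of_factors_right s ha) hx
  obtain ⟨z, hz, hz'⟩ := tU (s ≫ c) b x (Subobject.factors_of_factors_right s hc) hx
  obtain ⟨u, q, hu, hq, hm⟩ := exists_mem_inf
    (Subobject.factors_of_factors_right s hp) hy' hz'
  obtain ⟨w, hw, hl⟩ := h s b ![s ≫ p, s ≫ a, s ≫ c, b] rfl q
    ⟨_, _, ⟨_, _, rfl, ⟨_, _, rfl, rfl, hy⟩, hu⟩, ⟨_, _, rfl, rfl, hz⟩, hq⟩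
  exact ⟨w, hw, hm.down hl⟩

/-- Currying: `b` is sent to a realizer of `b' ↦ a (p b b')`, with `a` from the hypothesis and `p` a
pairing. By `exists_tracker₂` the inner realizer is one element at the stage of `b`, valid for all
later `b'`. -/
theorem le_allImp {f : X ⟶ Z} {R : RPred P Z} {Y Y' : RPred P X} (h : R.pull f ⊓ Y ≤ Y') :
    R ≤ allImp f Y.rel Y' := by
  obtain ⟨V, hV, tV⟩ := h
  obtain ⟨T, hT, h⟩ := P.exists_common_stage [V, pairing P,
    P.realizer (n := 4) (.app (.var 0) (.app (.app (.var 1) (.var 2)) (.var 3)))]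
    (by simp [P.intersects_realizer, hV])
  simp only [List.forall_mem_cons] at h
  obtain ⟨⟨a, ha, ha'⟩, ⟨p, hp, hp'⟩, ⟨β, hβ, hβ'⟩, -⟩ := h
  obtain ⟨d, hd, h⟩ := OPCAPair.exists_tracker₂ hβ hβ' [a, p] (by simp [ha', hp']) (by simp)
  refine le_of_stage hT d hd fun S s b z hz => ?_
  obtain ⟨c, hc, h⟩ := h s b
  refine ⟨c, hc, (mem_allImp _ _ _ _ _).2 fun S' s' b' x hx hb' => ?_⟩
  obtain ⟨u, q, hu, hq, hm⟩ := exists_mem_inf (Y := R.pull f) (Y' := Y) (a := s' ≫ b)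
    (Subobject.factors_of_factors_right (s' ≫ s) hp)
    (by rw [mem_pull, hx]; exact hz.precomp s') hb'
  obtain ⟨y, hy, hy'⟩ := tV ((s' ≫ s) ≫ a) q x (Subobject.factors_of_factors_right _ ha) hm
  obtain ⟨w, hw, hl⟩ := h s' b' ![(s' ≫ s) ≫ a, (s' ≫ s) ≫ p, s' ≫ b, b'] rfl y
    ⟨_, _, rfl, ⟨_, _, ⟨_, _, rfl, rfl, hu⟩, rfl, hq⟩, hy⟩
  exact ⟨w, hw, hy'.down hl⟩

/-- Uncurrying: the realizer is `b ↦ a (k b) (l b)`, with `k` and `l` tracking the two projections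
out of the conjunction. -/
theorem inf_le_of_le_allImp {f : X ⟶ Z} {R : RPred P Z} {Y Y' : RPred P X}
    (h : R ≤ allImp f Y.rel Y') : R.pull f ⊓ Y ≤ Y' := by
  obtain ⟨V, hV, tV⟩ := h
  obtain ⟨V₁, h₁, t₁⟩ := inf_le_left (R.pull f) Y
  obtain ⟨V₂, h₂, t₂⟩ := inf_le_right (R.pull f) Y
  obtain ⟨T, hT, h⟩ := P.exists_common_stage [V, V₁, V₂,
    P.realizer (n := 4) (.app (.app (.var 0) (.app (.var 1) (.var 3))) (.app (.var 2) (.var 3)))]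
    (by simp [P.intersects_realizer, hV, h₁, h₂])
  simp only [List.forall_mem_cons] at h
  obtain ⟨⟨a, ha, ha'⟩, ⟨k, hk, hk'⟩, ⟨l, hl, hl'⟩, ⟨β, hβ, hβ'⟩, -⟩ := h
  obtain ⟨d, hd, h⟩ := OPCAPair.exists_tracker hβ hβ' [a, k, l] (by simp [ha', hk', hl'])
    (by simp)
  refine le_of_stage hT d hd fun S s b x hx => ?_
  obtain ⟨y, hy, hy'⟩ := t₁ (s ≫ k) b x (Subobject.factors_of_factors_right s hk) hx
  obtain ⟨z, hz, hz'⟩ := t₂ (s ≫ l) b x (Subobject.factors_of_factors_right s hl) hx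
  rw [mem_pull] at hy'
  obtain ⟨u, hu, hu'⟩ := tV (s ≫ a) y _ (Subobject.factors_of_factors_right s ha) hy'
  obtain ⟨q, hq, hq'⟩ := (mem_allImp _ _ _ _ _).1 hu' (𝟙 S) z x (by rw [Category.id_comp]) hz'
  rw [Category.id_comp] at hq
  obtain ⟨w, hw, hl⟩ := h s b ![s ≫ a, s ≫ k, s ≫ l, b] rfl q
    ⟨_, _, ⟨_, _, rfl, ⟨_, _, rfl, rfl, hy⟩, hu⟩, ⟨_, _, rfl, rfl, hz⟩, hq⟩
  exact ⟨w, hw, hq'.down hl⟩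

/-- The same `V` works on both sides; from right to left the witness lives on a cover and the
conclusion descends. -/
theorem ex_le_iff {f : X ⟶ Z} {Y : RPred P X} {R : RPred P Z} :
    ex f Y ≤ R ↔ Y ≤ R.pull f := by
  constructor
  · rintro ⟨V, hV, tV⟩
    refine ⟨V, hV, fun T a b x ha hb => ?_⟩
    simp only [mem_pull]
    exact tV a b _ ha ((mem_ex _ _ _ _).2 ⟨T, 𝟙 T, x,
      (isRegularEpi_iff_strongEpi _).2 inferInstance, by simp, by simpa using hb⟩)
  · rintro ⟨V, hV, tV⟩
    refine ⟨V, hV, fun T a b z ha hb => ?_⟩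
    obtain ⟨S, e, x, he, h, hm⟩ := (mem_ex _ _ _ _).1 hb
    refine appMem_of_cover e ?_
    obtain ⟨c, h1, h2⟩ := tV (e ≫ a) _ x (Subobject.factors_of_factors_right e ha) hm
    rw [mem_pull, h] at h2
    exact ⟨c, h1, h2⟩

theorem le_pull_ex (f : X ⟶ Z) (Y : RPred P X) : Y ≤ (ex f Y).pull f :=
  ex_le_iff.1 le_rfl

theorem inf_mono {Y₁ Y₂ Y₁' Y₂' : RPred P X} (h : Y₁ ≤ Y₂) (h' : Y₁' ≤ Y₂') :
    Y₁ ⊓ Y₁' ≤ Y₂ ⊓ Y₂' :=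
  le_inf ((inf_le_left _ _).trans h) ((inf_le_right _ _).trans h')

theorem le_pull_inf (f : X ⟶ Z) (Y Y' : RPred P Z) : Y.pull f ⊓ Y'.pull f ≤ (Y ⊓ Y').pull f :=
  le_of_mem fun T a x h => by
    simpa only [mem_pull, mem_inf, Category.assoc] using h

/-- The Beck–Chevalley condition for `ex`. -/
theorem pull_ex_le {X' Z' : C} {f : X ⟶ Z} {g : Z' ⟶ Z} {f' : X' ⟶ Z'} {g' : X' ⟶ X}
    (h : IsPullback g' f' f g) (Y : RPred P X) : (ex f Y).pull g ≤ ex f' (Y.pull g') :=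
  le_of_mem fun T a z hz => by
    rw [mem_pull, mem_ex] at hz
    obtain ⟨S, e, x, he, hx, hm⟩ := hz
    rw [mem_ex]
    refine ⟨S, e, h.lift x (e ≫ z) (by simpa using hx), he, h.lift_snd _ _ _, ?_⟩
    rwa [mem_pull, h.lift_fst]

/-- The Beck–Chevalley condition for `allImp`. -/
theorem le_pull_allImp {X' Z' : C} {f : X ⟶ Z} {g : Z' ⟶ Z} {f' : X' ⟶ Z'} {g' : X' ⟶ X}
    (h : IsPullback g' f' f g) (Y Y' : RPred P X) :
    allImp f' (Y.pull g').rel (Y'.pull g') ≤ (allImp f Y.rel Y').pull g :=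
  le_of_mem fun T a z hz => by
    rw [mem_allImp] at hz
    rw [mem_pull, mem_allImp]
    intro S s b x hx hb
    obtain ⟨d, h1, h2⟩ := hz s b (h.lift x (s ≫ z) (by simpa using hx)) (h.lift_snd _ _ _)
      (by change (Y.pull g').Mem _ _; rwa [mem_pull, h.lift_fst])
    rw [mem_pull, h.lift_fst] at h2
    exact ⟨d, h1, h2⟩

/-- Frobenius reciprocity. -/
theorem inf_ex_le (f : X ⟶ Z) (R : RPred P Z) (Y : RPred P X) :
    R ⊓ ex f Y ≤ ex f (R.pull f ⊓ Y) := by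
  -- Frobenius holds because conjunction with `R` has a right adjoint, implication, that commutes
  -- with reindexing; after transposition the claim is checked over `X`.
  have h1 : ex f Y ≤ allImp (𝟙 Z) R.rel (ex f (R.pull f ⊓ Y)) := by
    rw [ex_le_iff]
    refine le_trans ?_ (le_pull_allImp (f' := 𝟙 X) (g' := f) (.of_vert_isIso ⟨by simp⟩) _ _)
    refine le_allImp (le_trans (le_inf (inf_le_right _ _) ?_) (le_pull_ex f _))
    exact (inf_le_left _ _).trans (le_of_mem fun T a x h => by simpa using h)
  refine le_trans (le_inf ?_ (inf_le_left _ _)) (inf_le_of_le_allImp h1)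
  exact (inf_le_right _ _).trans (le_of_mem fun T a x h => by simpa using h)

/-! #### Disjunction and falsity -/

/-- Disjunction: the realizers code tagged realizers. -/
noncomputable instance : Max (RPred P X) where
  max Y Y' := Classical.choose (exists_disj (const (n := 2) (.var 0) X ⊓ Y)
    (const (n := 2) (.var 1) X ⊓ Y'))


theorem sup_spec (Y Y' : RPred P X) :
    (const (n := 2) (.var 0) X ⊓ Y).rel ≤ (Y ⊔ Y').rel ∧
    (const (n := 2) (.var 1) X ⊓ Y').rel ≤ (Y ⊔ Y').rel ∧
      ∀ {T : C} (a : T ⟶ P.A.carrier) (x : T ⟶ X) (R : Subobject T), (Y ⊔ Y').Mem a x →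
      (∀ ⦃S : C⦄ (s : S ⟶ T), (const (n := 2) (.var 0) X ⊓ Y).Mem (s ≫ a) (s ≫ x) →
        R.Factors s) →
      (∀ ⦃S : C⦄ (s : S ⟶ T), (const (n := 2) (.var 1) X ⊓ Y').Mem (s ≫ a) (s ≫ x) →
        R.Factors s) → R.Factors (𝟙 T) :=
  Classical.choose_spec (exists_disj (const (n := 2) (.var 0) X ⊓ Y)
    (const (n := 2) (.var 1) X ⊓ Y'))

/-- A constant function is tracked by a first projection applied to the constant. This supplies the
tags for the two injections into a disjunction. -/
theorem le_const {n : ℕ} (t : CombTerm n) (Y : RPred P X) : Y ≤ const t X := by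
  obtain ⟨T, hT, h⟩ := P.exists_common_stage [P.realizer t, P.realizer (n := 2) (.var 0)]
    (by simp [P.intersects_realizer])
  simp only [List.forall_mem_cons] at h
  obtain ⟨⟨k, hk, hk'⟩, ⟨β, hβ, hβ'⟩, -⟩ := h
  obtain ⟨d, hd, h⟩ := OPCAPair.exists_tracker hβ hβ' [k] (by simp [hk']) (by simp)
  refine le_of_stage hT d hd fun S s b x hx => ?_
  obtain ⟨w, hw, hl⟩ := h s b ![s ≫ k, b] rfl (s ≫ k) rfl
  refine ⟨w, hw, Mem.down ?_ hl⟩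
  rw [mem_const]
  exact Subobject.factors_of_factors_right s hk

theorem le_sup_left (Y Y' : RPred P X) : Y ≤ Y ⊔ Y' :=
  (le_inf (le_const _ _) le_rfl).trans
    (le_of_mem fun _ _ _ h => Subobject.factors_of_le _ (sup_spec Y Y').1 h)

theorem le_sup_right (Y Y' : RPred P X) : Y' ≤ Y ⊔ Y' :=
  (le_inf (le_const _ _) le_rfl).trans
    (le_of_mem fun _ _ _ h => Subobject.factors_of_le _ (sup_spec Y Y').2.1 h)

/-- A realizer `c` codes a tag `c k` and a payload `c l`. The tag is itself a projection, so `c k a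
b` lies below `a` or `b`, and the combined realizer is `c ↦ (c k a b) (c l)`. -/
theorem sup_le {Y Y' R : RPred P X} (h : Y ≤ R) (h' : Y' ≤ R) : Y ⊔ Y' ≤ R := by
  obtain ⟨V, hV, tV⟩ := h
  obtain ⟨U, hU, tU⟩ := h'
  obtain ⟨T, hT, h⟩ := P.exists_common_stage [V, U, proj₁ P, proj₂ P,
    P.realizer (n := 5) (.app (.app (.app (.app (.var 4) (.var 2)) (.var 0)) (.var 1))
      (.app (.var 4) (.var 3)))]
    (by simp [P.intersects_realizer, hV, hU])
  simp only [List.forall_mem_cons] at h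
  obtain ⟨⟨a, ha, ha'⟩, ⟨b, hb, hb'⟩, ⟨k, hk, hk'⟩, ⟨l, hl, hl'⟩, ⟨β, hβ, hβ'⟩, -⟩ := h
  obtain ⟨d, hd, h⟩ := OPCAPair.exists_tracker hβ hβ' [a, b, k, l] (by simp [ha', hb', hk', hl'])
    (by simp)
  refine le_of_stage hT d hd fun S s c x hx => ?_
  -- The goal is recast as membership in a subobject of `S`, the form that elimination of the
  -- disjunction requires.
  obtain ⟨Q, hQ⟩ := exists_appMem (s ≫ d) c x R
  have key := (sup_spec Y Y').2.2 c x Q hx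
  rw [hQ] at key
  simp only [Category.id_comp, hQ] at key
  have step : ∀ ⦃S' : C⦄ (s' : S' ⟶ S) (κ w v y z : S' ⟶ P.A.carrier),
      P.A.App (s' ≫ c) (s' ≫ s ≫ k) κ → P.A.App (s' ≫ c) (s' ≫ s ≫ l) z →
      P.A.App κ (s' ≫ s ≫ a) w → P.A.App w (s' ≫ s ≫ b) v → P.A.App v z y →
      R.Mem y (s' ≫ x) → ∃ q, P.A.App (s' ≫ s ≫ d) (s' ≫ c) q ∧ R.Mem q (s' ≫ x) := by
    intro S' s' κ w v y z h1 h2 h3 h4 h5 hm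
    obtain ⟨q, hq, hl⟩ := h (s' ≫ s) (s' ≫ c) ![s' ≫ s ≫ a, s' ≫ s ≫ b, s' ≫ s ≫ k, s' ≫ s ≫ l,
      s' ≫ c] (by simp) y ⟨_, _, ⟨_, _, ⟨_, _, ⟨_, _, rfl, rfl, h1⟩, rfl, h3⟩, rfl, h4⟩,
        ⟨_, _, rfl, rfl, h2⟩, h5⟩
    rw [Category.assoc] at hq
    exact ⟨q, hq, hm.down hl⟩
  refine key (fun S' s' hm => ?_) fun S' s' hm => ?_
  all_goals
    rw [mem_inf] at hm
    obtain ⟨κ, h1, h2⟩ := hm.1 (𝟙 S') (s' ≫ s ≫ k)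
      (Subobject.factors_of_factors_right _ (Subobject.factors_of_factors_right _ hk))
    obtain ⟨z, h3, h4⟩ := hm.2 (𝟙 S') (s' ≫ s ≫ l)
      (Subobject.factors_of_factors_right _ (Subobject.factors_of_factors_right _ hl))
    rw [mem_const] at h2
    rw [Category.id_comp] at h1 h3 h4
  · obtain ⟨w, v, h5, h6, h7⟩ := proj₁_spec h2 (s' ≫ s ≫ a) (s' ≫ s ≫ b)
    obtain ⟨y, h8, h9⟩ := tV (s' ≫ s ≫ a) z _
      (Subobject.factors_of_factors_right _ (Subobject.factors_of_factors_right _ ha)) h4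
    obtain ⟨y', h10, h11⟩ := P.A.app_mono _ _ _ _ _ h7 (P.A.le_refl z) h8
    exact step s' κ w v y' z h1 h3 h5 h6 h10 (h9.down h11)
  · obtain ⟨w, v, h5, h6, h7⟩ := proj₂_spec h2 (s' ≫ s ≫ a) (s' ≫ s ≫ b)
    obtain ⟨y, h8, h9⟩ := tU (s' ≫ s ≫ b) z _
      (Subobject.factors_of_factors_right _ (Subobject.factors_of_factors_right _ hb)) h4
    obtain ⟨y', h10, h11⟩ := P.A.app_mono _ _ _ _ _ h7 (P.A.le_refl z) h8
    exact step s' κ w v y' z h1 h3 h5 h6 h10 (h9.down h11)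

theorem exists_least (P : OPCAPair C) (X : C) : ∃ Y : RPred P X, ∀ Y' : RPred P X, Y ≤ Y' := by
  obtain ⟨W, hW⟩ := exists_bot (P.A.carrier ⨯ X)
  have key : ∀ {T : C} {a : T ⟶ P.A.carrier} {x : T ⟶ X} (Y' : RPred P X) (b : T ⟶ P.A.carrier),
      W.Factors (prod.lift a x) → Y'.Mem b x := by
    intro T a x Y' b h
    have := hW _ ((Subobject.pullback (prod.lift b x)).obj Y'.rel) h
    rwa [factors_pullback_iff, Category.id_comp] at this
  refine ⟨⟨W, fun a b x h _ => ?_⟩, fun Y' => le_of_mem fun T a x h => key Y' a h⟩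
  have := hW _ ((Subobject.pullback (prod.lift b x)).obj W) h
  rwa [factors_pullback_iff, Category.id_comp] at this

/-! #### Supports -/

/-- A tracking element exists at an inhabited stage, and multiplying by that stage is a cover. -/
theorem supp_mono {Y Y' : RPred P X} (h : Y ≤ Y') : Y.supp ≤ Y'.supp := by
  obtain ⟨V, hV, tV⟩ := h
  obtain ⟨T, a, hT, ha, -⟩ := (intersects_iff _ _).1 hV
  refine Subobject.le_of_factors ?_
  obtain ⟨S, e, b, he, hb⟩ := (mem_supp _ _).1 (Subobject.factors_self Y.supp)
  let p := pullback.fst (terminal.from S) (terminal.from T)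
  let q := pullback.snd (terminal.from S) (terminal.from T)
  obtain ⟨c, -, hc⟩ := tV (q ≫ a) (p ≫ b) _ (Subobject.factors_of_factors_right q ha)
    (hb.precomp p)
  rw [mem_supp]
  exact ⟨_, p ≫ e, c, isRegularEpi_comp _ _, by rwa [Category.assoc]⟩

/-- Two local realizers and a pairing element meet on a common cover, where they can be paired. -/
theorem factors_supp_inf {Y Y' : RPred P X} {T : C} {x : T ⟶ X} (h : Y.supp.Factors x)
    (h' : Y'.supp.Factors x) : (Y ⊓ Y').supp.Factors x := by
  obtain ⟨R, p, hR, hp, -⟩ := (intersects_iff _ _).1 (P.intersects_realizer (n := 3)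
    (.app (.app (.var 2) (.var 0)) (.var 1)))
  obtain ⟨S, e, a, he, ha⟩ := (mem_supp _ _).1 h
  obtain ⟨S', e', a', he', ha'⟩ := (mem_supp _ _).1 h'
  let Q := pullback e e'
  let i := pullback.fst (terminal.from Q) (terminal.from R)
  let j := pullback.snd (terminal.from Q) (terminal.from R)
  let k : Q ⟶ S := pullback.fst e e'
  let k' : Q ⟶ S' := pullback.snd e e'
  have hk : k ≫ e = k' ≫ e' := pullback.condition
  obtain ⟨-, c, -, -, hc⟩ := exists_mem_inf (Subobject.factors_of_factors_right j hp)
    (ha.precomp (i ≫ k)) (Y' := Y') (b := (i ≫ k') ≫ a') (by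
      have := ha'.precomp (i ≫ k')
      simp only [Category.assoc] at this ⊢
      rwa [reassoc_of% hk])
  rw [mem_supp]
  have : IsRegularEpi (i ≫ k) := isRegularEpi_comp _ _
  exact ⟨_, (i ≫ k) ≫ e, c, isRegularEpi_comp _ _, by rwa [Category.assoc]⟩

theorem factors_supp_pull {f : X ⟶ Z} {Y : RPred P Z} {T : C} {x : T ⟶ X} :
    (Y.pull f).supp.Factors x ↔ Y.supp.Factors (x ≫ f) := by
  simp only [mem_supp, mem_pull, Category.assoc]

/-- This needs `A` to be inhabited; a realizer of the identity provides a local element. -/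
theorem factors_supp_top {T : C} (x : T ⟶ X) : (⊤ : RPred P X).supp.Factors x := by
  obtain ⟨R, p, hR, hp, -⟩ := (intersects_iff _ _).1 (P.intersects_realizer (n := 1) (.var 0))
  rw [mem_supp]
  exact ⟨_, pullback.fst (terminal.from T) (terminal.from R), pullback.snd _ _ ≫ p, inferInstance,
    mem_top _ _⟩

theorem factors_supp_ex {f : X ⟶ Z} {Y : RPred P X} {T S : C} {z : T ⟶ Z} (e : S ⟶ T)
    [IsRegularEpi e] {x : S ⟶ X} (h : x ≫ f = e ≫ z) (hx : Y.supp.Factors x) :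
    (ex f Y).supp.Factors z := by
  have := supp_mono (le_pull_ex f Y)
  have := Subobject.factors_of_le x this hx
  rw [factors_supp_pull, h] at this
  exact factors_of_cover _ e _ this

end RPred

end Entailment

/-! ### Assemblies as predicates with full support -/

section Assemblies

variable {C : Type u} [Category.{v} C] [HeytingCategory C] {P : OPCAPair C}

theorem RPred.ex_mono {X Z : C} (f : X ⟶ Z) {Y Y' : RPred P X} (h : Y ≤ Y') :
    RPred.ex f Y ≤ RPred.ex f Y' :=
  RPred.ex_le_iff.2 (h.trans (RPred.le_pull_ex f Y'))

namespace Assembly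

/-- The realizability predicate of an assembly. -/
def pred (M : Assembly P) : RPred P M.X := ⟨M.Y, M.down⟩

theorem factors_supp_pred (M : Assembly P) {T : C} (x : T ⟶ M.X) : M.pred.supp.Factors x := by
  have := M.cover
  rw [RPred.mem_supp]
  refine ⟨pullback x (M.Y.arrow ≫ prod.snd), pullback.fst _ _,
    pullback.snd _ _ ≫ M.Y.arrow ≫ prod.fst, inferInstance, ?_⟩
  rw [pullback.condition, RPred.Mem, ← Category.assoc, ← Category.assoc, lift_comp_fst_snd]
  exact Subobject.factors_comp_arrow _

/-- The assembly of a predicate all of whose elements are realized. -/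
noncomputable def of {X : C} (Y : RPred P X) (h : Y.supp.Factors (𝟙 X)) : Assembly P where
  X := X
  Y := Y.rel
  cover := by
    obtain ⟨S, e, a, he, ha⟩ := (RPred.mem_supp _ _).1 h
    rw [Category.comp_id, RPred.Mem] at ha
    have : e = Y.rel.factorThru _ ha ≫ Y.rel.arrow ≫ prod.snd := by
      rw [Subobject.factorThru_arrow_assoc, prod.lift_snd]
    rw [this] at he
    exact isRegularEpi_of_comp (Y.rel.factorThru _ ha) _
  down := Y.down'

/-- An arrow that respects realizability predicates, as a morphism. -/
def homMk {M N : Assembly P} (f : M.X ⟶ N.X) (h : M.pred ≤ N.pred.pull f) : M ⟶ N where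
  hom := f
  tracked := by
    obtain ⟨V, hV, t⟩ := h
    refine ⟨V, hV, fun T a b x ha hb => ?_⟩
    obtain ⟨c, h1, h2⟩ := t a b x ha hb
    exact ⟨c, h1, (RPred.mem_pull _ _ _ _).1 h2⟩

/-- Together with `homMk` this turns every tracking condition into an entailment. -/
theorem pred_le_pull {M N : Assembly P} (f : M ⟶ N) : M.pred ≤ N.pred.pull f.hom := by
  obtain ⟨V, hV, t⟩ := f.tracked
  refine ⟨V, hV, fun T a b x ha hb => ?_⟩
  obtain ⟨c, h1, h2⟩ := t a b x ha hb
  exact ⟨c, h1, (RPred.mem_pull _ _ _ _).2 h2⟩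

@[simp]
theorem homMk_hom {M N : Assembly P} (f : M.X ⟶ N.X) (h : M.pred ≤ N.pred.pull f) :
    (homMk f h).hom = f := rfl

@[simp]
theorem comp_hom {M N K : Assembly P} (f : M ⟶ N) (g : N ⟶ K) : (f ≫ g).hom = f.hom ≫ g.hom := rfl

@[simp]
theorem id_hom (M : Assembly P) : Hom.hom (𝟙 M) = 𝟙 M.X := rfl

theorem hom_ext {M N : Assembly P} {f g : M ⟶ N} (h : f.hom = g.hom) : f = g :=
  Hom.ext h

variable (P) in
/-- The underlying object of an assembly. -/
@[simps]
def forget : Assembly P ⥤ C where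
  obj M := M.X
  map f := f.hom

/-! #### Finite limits -/

/-- The mediating arrow of the base is tracked by pairing the realizers of its two components. Only
one inequality is assumed; the other holds because `p` and `q` are morphisms. -/
theorem isPullback_of {A B M N : Assembly P} {p : A ⟶ B} {q : A ⟶ M} {f : B ⟶ N} {g : M ⟶ N}
    (h : IsPullback p.hom q.hom f.hom g.hom)
    (hle : B.pred.pull p.hom ⊓ M.pred.pull q.hom ≤ A.pred) : IsPullback p q f g where
  w := hom_ext h.w
  isLimit' := ⟨PullbackCone.IsLimit.mk _
    (fun s => homMk (h.lift s.fst.hom s.snd.hom (congrArg Hom.hom s.condition)) (by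
      refine le_trans ?_ (RPred.pull_mono _ hle)
      refine le_trans (RPred.le_inf ?_ ?_) (RPred.le_pull_inf _ _ _)
      · refine le_trans ?_ (RPred.pull_comp_le _ _ _)
        rw [h.lift_fst]
        exact (pred_le_pull s.fst)
      · refine le_trans ?_ (RPred.pull_comp_le _ _ _)
        rw [h.lift_snd]
        exact (pred_le_pull s.snd)))
    (fun s => hom_ext (h.lift_fst _ _ _)) (fun s => hom_ext (h.lift_snd _ _ _))
    (fun s m h1 h2 => hom_ext (h.hom_ext
      ((congrArg Hom.hom h1).trans (h.lift_fst _ _ _).symm)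
      ((congrArg Hom.hom h2).trans (h.lift_snd _ _ _).symm)))⟩

theorem exists_isPullback {B M N : Assembly P} (f : B ⟶ N) (g : M ⟶ N) :
    ∃ (A : Assembly P) (p : A ⟶ B) (q : A ⟶ M), IsPullback p q f g ∧
      IsPullback p.hom q.hom f.hom g.hom ∧
      B.pred.pull p.hom ⊓ M.pred.pull q.hom ≤ A.pred := by
  have h := IsPullback.of_hasPullback f.hom g.hom
  let A : Assembly P := of (B.pred.pull (pullback.fst f.hom g.hom) ⊓
    M.pred.pull (pullback.snd f.hom g.hom)) (RPred.factors_supp_inf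
      (RPred.factors_supp_pull.2 (B.factors_supp_pred _))
      (RPred.factors_supp_pull.2 (M.factors_supp_pred _)))
  let p : A ⟶ B := homMk (pullback.fst f.hom g.hom) (RPred.inf_le_left _ _)
  let q : A ⟶ M := homMk (pullback.snd f.hom g.hom) (RPred.inf_le_right _ _)
  exact ⟨A, p, q, isPullback_of (p := p) (q := q) h le_rfl, h, le_rfl⟩

/-- Any pullback is isomorphic to the explicit one of `exists_isPullback`, and both conditions
transport along the isomorphism. -/
theorem isPullback_iff {A B M N : Assembly P} {p : A ⟶ B} {q : A ⟶ M} {f : B ⟶ N} {g : M ⟶ N} :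
    IsPullback p q f g ↔ IsPullback p.hom q.hom f.hom g.hom ∧
      B.pred.pull p.hom ⊓ M.pred.pull q.hom ≤ A.pred := by
  refine ⟨fun h => ?_, fun h => isPullback_of h.1 h.2⟩
  obtain ⟨A', p', q', h', h1, h2⟩ := exists_isPullback f g
  let e := h.isoIsPullback _ _ h'
  have e1 : e.hom ≫ p' = p := h.isoIsPullback_hom_fst _ _ h'
  have e2 : e.hom ≫ q' = q := h.isoIsPullback_hom_snd _ _ h'
  have e3 : e.inv ≫ p = p' := h.isoIsPullback_inv_fst _ _ h'
  have e4 : e.inv ≫ q = q' := h.isoIsPullback_inv_snd _ _ h'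
  constructor
  · refine IsPullback.of_iso h1 ((forget P).mapIso e).symm (Iso.refl _) (Iso.refl _) (Iso.refl _)
      ?_ ?_ ?_ ?_
    · simp [← e3]
    · simp [← e4]
    · simp
    · simp
  · have : A'.pred.pull e.hom.hom ≤ A.pred := by
      refine (RPred.pull_mono _ (pred_le_pull e.inv)).trans ((RPred.le_pull_comp _ _ _).trans ?_)
      rw [← comp_hom, e.hom_inv_id]
      exact RPred.le_of_mem fun T a x h => by simpa using h
    refine le_trans ?_ this
    refine le_trans ?_ (RPred.pull_mono _ h2)
    refine le_trans ?_ (RPred.le_pull_inf _ _ _)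
    rw [← e1, ← e2]
    exact RPred.inf_mono (RPred.pull_comp_le _ _ _) (RPred.pull_comp_le _ _ _)

instance : HasPullbacks (Assembly P) :=
  have (B M N : Assembly P) (f : B ⟶ N) (g : M ⟶ N) : HasLimit (cospan f g) := by
    obtain ⟨A, p, q, h, -⟩ := exists_isPullback f g
    exact h.hasPullback
  hasPullbacks_of_hasLimit_cospan _

instance : HasTerminal (Assembly P) := by
  let N : Assembly P := of (⊤ : RPred P (⊤_ C)) (RPred.factors_supp_top _)
  refine IsTerminal.hasTerminal (X := N) (IsTerminal.ofUniqueHom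
    (fun M => homMk (terminal.from M.X) ?_) fun M f => hom_ext (terminal.hom_ext f.hom _))
  exact RPred.le_of_mem fun T a x _ => (RPred.mem_pull _ _ _ _).2 (RPred.mem_top _ _)

instance : HasFiniteLimits (Assembly P) := hasFiniteLimits_of_hasTerminal_and_pullbacks

/-- A monomorphism is an arrow with trivial kernel pair, and `forget` preserves pullbacks. -/
theorem mono_iff {M N : Assembly P} (f : M ⟶ N) : Mono f ↔ Mono f.hom := by
  constructor
  · intro h
    have := (isPullback_iff.1 (IsKernelPair.id_of_mono f)).1
    have : IsKernelPair f.hom (𝟙 _) (𝟙 _) := this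
    exact this.mono_of_eq_fst_snd rfl
  · intro h
    exact ⟨fun g k e => hom_ext ((cancel_mono f.hom).1 (congrArg Hom.hom e))⟩

/-! #### Regular epimorphisms -/

/-- The image in the base gets the predicate `ex e M.pred`, the least one for which `e` is a
morphism. -/
theorem exists_factorisation {M N : Assembly P} (f : M ⟶ N) :
    ∃ (I : Assembly P) (e : M ⟶ I) (m : I ⟶ N), e ≫ m = f ∧ IsRegularEpi e.hom ∧
      I.pred ≤ RPred.ex e.hom M.pred ∧ Mono m := by
  obtain ⟨I, e, he, h⟩ := exists_image f.hom
  have hI : (RPred.ex e M.pred).supp.Factors (𝟙 (I : C)) :=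
    RPred.factors_supp_ex e (x := 𝟙 _) (by simp) (M.factors_supp_pred _)
  let e' : M ⟶ of _ hI := homMk e (RPred.le_pull_ex e M.pred)
  let m : of _ hI ⟶ N := homMk I.arrow (RPred.ex_le_iff.2 (by
    have h1 := RPred.pull_comp_le e I.arrow N.pred
    rw [h] at h1
    exact (pred_le_pull f).trans h1))
  exact ⟨of _ hI, e', m, hom_ext h, he, le_rfl, (mono_iff m).2 (inferInstanceAs (Mono I.arrow))⟩

/-- The base supplies the induced arrow; since `ex` is left adjoint to reindexing, `hle` reduces its
tracking to that of the given cofork. -/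
theorem nonempty_isColimit_of_isKernelPair {M N Z : Assembly P} {f : M ⟶ N} {g₁ g₂ : Z ⟶ M}
    (k : IsKernelPair f g₁ g₂) (hf : IsRegularEpi f.hom) (hle : N.pred ≤ RPred.ex f.hom M.pred) :
    Nonempty (IsColimit (Cofork.ofπ f k.w)) := by
  have k' : IsKernelPair f.hom g₁.hom g₂.hom := (isPullback_iff.1 k).1
  obtain ⟨⟨r⟩⟩ := hf
  have hc := k'.toCoequalizer r
  refine ⟨Cofork.IsColimit.ofExistsUnique fun s => ?_⟩
  obtain ⟨d, hd, hu⟩ := Cofork.IsColimit.existsUnique hc s.π.hom (congrArg Hom.hom s.condition)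
  change f.hom ≫ d = s.π.hom at hd
  have hle' : N.pred ≤ s.pt.pred.pull d := by
    refine hle.trans (RPred.ex_le_iff.2 (le_trans ?_ (RPred.pull_comp_le _ _ _)))
    rw [hd]
    exact (pred_le_pull s.π)
  exact ⟨homMk d hle', hom_ext hd, fun m hm => hom_ext (hu _ (congrArg Hom.hom hm))⟩

/-- A regular epimorphism is extremal, so the mono part of its factorisation is invertible and it
inherits both properties of the first part. -/
theorem isRegularEpi_iff {M N : Assembly P} (f : M ⟶ N) :
    IsRegularEpi f ↔ IsRegularEpi f.hom ∧ N.pred ≤ RPred.ex f.hom M.pred := by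
  constructor
  · intro hf
    obtain ⟨I, e, m, rfl, he, hle, hm⟩ := exists_factorisation f
    have : IsIso m := ExtremalEpi.isIso (e ≫ m) e m rfl
    have : IsIso m.hom := inferInstanceAs (IsIso ((forget P).map m))
    have : IsRegularEpi m.hom := (isRegularEpi_iff_strongEpi _).2 inferInstance
    refine ⟨isRegularEpi_comp e.hom m.hom, ?_⟩
    have h1 : I.pred ≤ (RPred.ex (e ≫ m).hom M.pred).pull m.hom :=
      hle.trans (RPred.ex_le_iff.2 ((RPred.le_pull_ex _ _).trans (RPred.pull_comp_le _ _ _)))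
    refine (pred_le_pull (inv m)).trans
      ((RPred.pull_mono _ h1).trans ((RPred.le_pull_comp _ _ _).trans ?_))
    rw [← comp_hom, IsIso.inv_hom_id]
    exact RPred.le_of_mem fun T a x h => by simpa using h
  · rintro ⟨h1, h2⟩
    have k := IsKernelPair.of_hasPullback f
    obtain ⟨h⟩ := nonempty_isColimit_of_isKernelPair k h1 h2
    exact ⟨⟨⟨_, _, _, k.w, h⟩⟩⟩

instance : Regular (Assembly P) where
  hasCoequalizer_of_isKernelPair {M N Z f g₁ g₂} k := by
    -- As `m` is mono, the kernel pair of `e ≫ m` is also that of `e`, and `e` is its coequalizer.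
    obtain ⟨I, e, m, rfl, he, hle, hm⟩ := exists_factorisation f
    obtain ⟨h⟩ := nonempty_isColimit_of_isKernelPair k.cancel_right_of_mono he hle
    exact ⟨_, h⟩
  regularEpiIsStableUnderBaseChange := by
    refine ⟨fun {N' M N M'} g f p q sq (hf : IsRegularEpi _) => ?_⟩
    change IsRegularEpi _
    rw [isRegularEpi_iff] at hf ⊢
    obtain ⟨h1, h2⟩ := isPullback_iff.1 sq
    refine ⟨Regular.regularEpiIsStableUnderBaseChange.of_isPullback h1 hf.1, ?_⟩
    -- Beck–Chevalley lifts realizers through the pullback square, and Frobenius moves the remaining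
    -- conjunct under `ex`, where `h2` applies.
    refine le_trans (RPred.le_inf le_rfl ?_) ((RPred.inf_ex_le _ _ _).trans (RPred.ex_mono _
      (le_trans (RPred.le_inf (RPred.inf_le_right _ _) (RPred.inf_le_left _ _)) h2)))
    exact (pred_le_pull g).trans ((RPred.pull_mono _ hf.2).trans (RPred.pull_ex_le h1 _))

/-! #### Subobjects -/

/-- A predicate restricts to an assembly on its support. -/
theorem exists_support {X : C} (Y : RPred P X) :
    ∃ (E : Assembly P) (j : E.X ⟶ X), Mono j ∧ E.pred ≤ Y.pull j ∧ Y.pull j ≤ E.pred ∧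
      ∀ {T : C} (x : T ⟶ X), Y.supp.Factors x → ∃ x' : T ⟶ E.X, x' ≫ j = x :=
  ⟨of (Y.pull Y.supp.arrow) (RPred.factors_supp_pull.2 (Subobject.factors_comp_arrow _)),
    Y.supp.arrow, inferInstanceAs (Mono Y.supp.arrow), le_rfl, le_rfl,
    fun x h => ⟨Y.supp.factorThru x h, Subobject.factorThru_arrow _ _ _⟩⟩

/-- The realizability predicate on `M` of a subobject. -/
noncomputable def subPred {M : Assembly P} (U : Subobject M) : RPred P M.X :=
  RPred.ex U.arrow.hom (U : Assembly P).pred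

theorem ex_le_ex_of_hom {A B M : Assembly P} {a : A ⟶ M} {b : B ⟶ M} (l : A ⟶ B)
    (h : l ≫ b = a) : RPred.ex a.hom A.pred ≤ RPred.ex b.hom B.pred := by
  subst h
  exact RPred.ex_le_iff.2 ((pred_le_pull l).trans
    ((RPred.pull_mono _ (RPred.le_pull_ex _ _)).trans (RPred.le_pull_comp _ _ _)))

theorem subPred_le {M : Assembly P} (U : Subobject M) : subPred U ≤ M.pred :=
  RPred.ex_le_iff.2 (pred_le_pull U.arrow)

/-- The support of `subPred V` lies in the subobject of the base under `V`, so comparing supports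
yields the factorisation `g`. It is tracked because `ex` followed by reindexing along a monomorphism
adds no realizers. -/
theorem le_of_subPred_le {M : Assembly P} {U V : Subobject M} (h : subPred U ≤ subPred V) :
    U ≤ V := by
  have hV : Mono V.arrow.hom := (mono_iff V.arrow).1 inferInstance
  have hx : (RPred.ex V.arrow.hom (V : Assembly P).pred).supp.Factors U.arrow.hom := by
    refine Subobject.factors_of_le _ (RPred.supp_mono h) ?_
    exact RPred.factors_supp_ex (𝟙 _) (x := 𝟙 _) (by simp) (factors_supp_pred _ _)
  have hle : (RPred.ex V.arrow.hom (V : Assembly P).pred).supp ≤ Subobject.mk V.arrow.hom := by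
    refine Subobject.le_of_factors ?_
    obtain ⟨S, e, a, he, ha⟩ := (RPred.mem_supp _ _).1 (Subobject.factors_self
      (RPred.ex V.arrow.hom (V : Assembly P).pred).supp)
    obtain ⟨S', e', x, he', hx, -⟩ := (RPred.mem_ex _ _ _ _).1 ha
    refine factors_of_cover _ e _ (factors_of_cover _ e' _ ?_)
    rw [← hx]
    exact Subobject.factors_of_factors_right _ (Subobject.mk_factors_self _)
  have hg := (Subobject.mk_factors_iff _ _).1 (Subobject.factors_of_le _ hle hx)
  obtain ⟨g, hg⟩ : ∃ g, g ≫ V.arrow.hom = U.arrow.hom := hg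
  -- Beck–Chevalley is used for the trivial kernel pair of `V.arrow.hom`.
  have hmono : IsPullback (𝟙 _) (𝟙 _) V.arrow.hom V.arrow.hom := IsKernelPair.id_of_mono _
  refine Subobject.le_of_comm (homMk g ?_) (hom_ext hg)
  have h1 := (RPred.le_pull_ex U.arrow.hom _).trans (RPred.pull_mono U.arrow.hom h)
  rw [← hg] at h1
  refine h1.trans ((RPred.pull_comp_le _ _ _).trans (RPred.pull_mono _ ?_))
  refine (RPred.pull_ex_le hmono _).trans (RPred.ex_le_iff.2 ?_)
  exact RPred.le_of_mem fun T a x h => by simpa using h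

theorem subPred_le_iff {M : Assembly P} {U V : Subobject M} : subPred U ≤ subPred V ↔ U ≤ V :=
  ⟨le_of_subPred_le, fun h => ex_le_ex_of_hom (Subobject.ofLE U V h) (Subobject.ofLE_arrow h)⟩

/-- The subobject is `Y` restricted to its support, and `h` makes the inclusion a morphism. Nothing
is lost, since whatever has a realizer lies in the support. -/
theorem exists_subPred {M : Assembly P} (Y : RPred P M.X) (h : Y ≤ M.pred) :
    ∃ U : Subobject M, subPred U ≤ Y ∧ Y ≤ subPred U := by
  obtain ⟨E, i, hi, hE, hE', hlift⟩ := exists_support Y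
  let j : E ⟶ M := homMk i (hE.trans (RPred.pull_mono i h))
  have : Mono j := (mono_iff j).2 hi
  refine ⟨Subobject.mk j, ?_, ?_⟩
  · exact (ex_le_ex_of_hom (Subobject.underlyingIso j).hom
      (Subobject.underlyingIso_hom_comp_eq_mk j)).trans (RPred.ex_le_iff.2 hE)
  · refine le_trans ?_ (ex_le_ex_of_hom (a := j) (Subobject.underlyingIso j).inv
      (Subobject.underlyingIso_arrow j))
    refine le_trans ?_ (RPred.ex_mono i hE')
    refine RPred.le_of_mem fun T a x ha => (RPred.mem_ex _ _ _ _).2 ?_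
    obtain ⟨x', hx⟩ := hlift x ((RPred.mem_supp _ _).2
      ⟨T, 𝟙 T, a, (isRegularEpi_iff_strongEpi _).2 inferInstance, by simpa using ha⟩)
    exact ⟨T, 𝟙 T, x', (isRegularEpi_iff_strongEpi _).2 inferInstance, by simpa using hx,
      by simpa [hx] using ha⟩

theorem subPred_pullback_le {M N : Assembly P} (f : M ⟶ N) (V : Subobject N) :
    subPred ((Subobject.pullback f).obj V) ≤ (subPred V).pull f.hom ⊓ M.pred := by
  refine RPred.le_inf (RPred.ex_le_iff.2 ?_) (subPred_le _)
  refine (pred_le_pull (Subobject.pullbackπ f V)).trans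
    ((RPred.pull_mono _ (RPred.le_pull_ex V.arrow.hom _)).trans
      ((RPred.le_pull_comp _ _ _).trans ?_))
  rw [← comp_hom, (Subobject.isPullback f V).w]
  exact RPred.pull_comp_le _ _ _

/-- Beck–Chevalley for the pullback square, then Frobenius. The conjunct `M.pred` keeps the
reindexed predicate among those that stand for subobjects of `M`. -/
theorem le_subPred_pullback {M N : Assembly P} (f : M ⟶ N) (V : Subobject N) :
    (subPred V).pull f.hom ⊓ M.pred ≤ subPred ((Subobject.pullback f).obj V) := by
  obtain ⟨h1, h2⟩ := isPullback_iff.1 (Subobject.isPullback f V)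
  refine le_trans (RPred.le_inf (RPred.inf_le_right _ _)
    ((RPred.inf_le_left _ _).trans (RPred.pull_ex_le h1 _))) ?_
  refine (RPred.inf_ex_le _ _ _).trans (RPred.ex_mono _ (le_trans ?_ h2))
  exact RPred.le_inf (RPred.inf_le_right _ _) (RPred.inf_le_left _ _)

theorem exists_heyting (M : Assembly P) :
    ∃ H : HeytingAlgebra (Subobject M), ∀ U V : Subobject M, H.le U V ↔ U ≤ V := by
  have hsup : ∀ U V : Subobject M, ∃ W : Subobject M, ∀ Z, W ≤ Z ↔ U ≤ Z ∧ V ≤ Z := by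
    intro U V
    obtain ⟨W, h1, h2⟩ := exists_subPred (subPred U ⊔ subPred V)
      (RPred.sup_le (subPred_le U) (subPred_le V))
    refine ⟨W, fun Z => ?_⟩
    simp only [← subPred_le_iff]
    exact ⟨fun h => ⟨((RPred.le_sup_left _ _).trans h2).trans h,
      ((RPred.le_sup_right _ _).trans h2).trans h⟩, fun h => h1.trans (RPred.sup_le h.1 h.2)⟩
  have hbot : ∃ W : Subobject M, ∀ Z, W ≤ Z := by
    obtain ⟨Y, hY⟩ := RPred.exists_least P M.X
    obtain ⟨W, h1, -⟩ := exists_subPred Y (hY _)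
    exact ⟨W, fun Z => le_of_subPred_le (h1.trans (hY _))⟩
  have himp : ∀ U V : Subobject M, ∃ W : Subobject M, ∀ Z, Z ≤ W ↔ Z ⊓ U ≤ V := by
    intro U V
    -- Implication may exceed `M.pred`, so it is cut down before it is turned into a subobject.
    obtain ⟨W, h1, h2⟩ := exists_subPred
      (RPred.allImp (𝟙 M.X) (subPred U).rel (subPred V) ⊓ M.pred) (RPred.inf_le_right _ _)
    refine ⟨W, fun Z => ?_⟩
    have hinf : subPred Z ⊓ subPred U ≤ subPred (Z ⊓ U) := by
      obtain ⟨Q, h3, h4⟩ := exists_subPred (subPred Z ⊓ subPred U)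
        ((RPred.inf_le_left _ _).trans (subPred_le Z))
      refine h4.trans (subPred_le_iff.2 (le_inf ?_ ?_))
      · exact le_of_subPred_le (h3.trans (RPred.inf_le_left _ _))
      · exact le_of_subPred_le (h3.trans (RPred.inf_le_right _ _))
    rw [← subPred_le_iff, ← subPred_le_iff]
    constructor
    · intro h
      have h3 := RPred.inf_le_of_le_allImp (h.trans (h1.trans (RPred.inf_le_left _ _)))
      refine le_trans (RPred.le_inf ?_ (subPred_le_iff.2 inf_le_right)) h3
      refine (subPred_le_iff.2 inf_le_left).trans ?_
      exact RPred.le_of_mem fun T a x h => by simpa using h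
    · intro h
      refine le_trans (RPred.le_inf (RPred.le_allImp (le_trans ?_ (hinf.trans h)))
        (subPred_le Z)) h2
      exact RPred.inf_mono (RPred.le_of_mem fun T a x h => by simpa using h) le_rfl
  choose sup hsup using hsup
  obtain ⟨bot, hbot⟩ := hbot
  choose imp himp using himp
  let H : HeytingAlgebra (Subobject M) :=
    { (inferInstance : SemilatticeInf (Subobject M)), (inferInstance : OrderTop (Subobject M)) with
      sup := sup
      le_sup_left := fun U V => ((hsup U V _).1 le_rfl).1
      le_sup_right := fun U V => ((hsup U V _).1 le_rfl).2
      sup_le := fun U V Z h h' => (hsup U V Z).2 ⟨h, h'⟩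
      bot := bot
      bot_le := hbot
      himp := imp
      le_himp_iff := fun Z U V => himp U V Z
      compl := fun U => imp U bot
      himp_bot := fun _ => rfl }
  exact ⟨H, fun U V => Iff.rfl⟩

instance : HeytingCategory (Assembly P) where
  heyting := exists_heyting
  exists_im {M N} f := by
    have him : ∀ U : Subobject M, ∃ W : Subobject N, ∀ V, W ≤ V ↔
        U ≤ (Subobject.pullback f).obj V := by
      intro U
      obtain ⟨W, h1, h2⟩ := exists_subPred (RPred.ex f.hom (subPred U))
        (RPred.ex_le_iff.2 ((subPred_le U).trans (pred_le_pull f)))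
      refine ⟨W, fun V => ?_⟩
      rw [← subPred_le_iff, ← subPred_le_iff]
      constructor
      · intro h
        exact le_trans (RPred.le_inf (RPred.ex_le_iff.1 (h2.trans h)) (subPred_le U))
          (le_subPred_pullback f V)
      · intro h
        exact h1.trans (RPred.ex_le_iff.2
          ((h.trans (subPred_pullback_le f V)).trans (RPred.inf_le_left _ _)))
    choose im him using him
    exact ⟨im, fun U V => him U V⟩
  exists_all {M N} f := by
    have hall : ∀ U : Subobject M, ∃ W : Subobject N, ∀ V,
        (Subobject.pullback f).obj V ≤ U ↔ V ≤ W := by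
      intro U
      -- The quantifier is bounded by `M.pred`: a realizer may use a realizer of the point of `M`.
      -- Conjunction with `N.pred` brings the result below `N.pred`.
      obtain ⟨W, h1, h2⟩ := exists_subPred
        (RPred.allImp f.hom M.pred.rel (subPred U) ⊓ N.pred) (RPred.inf_le_right _ _)
      refine ⟨W, fun V => ?_⟩
      rw [← subPred_le_iff, ← subPred_le_iff]
      constructor
      · intro h
        exact le_trans (RPred.le_inf (RPred.le_allImp ((le_subPred_pullback f V).trans h))
          (subPred_le V)) h2
      · intro h
        exact (subPred_pullback_le f V).trans
          (RPred.inf_le_of_le_allImp (h.trans (h1.trans (RPred.inf_le_left _ _))))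
    choose all hall using hall
    exact ⟨all, fun V U => hall U V⟩

end Assembly

end Assemblies

/-! ### Local cartesian closure by universal property -/

section Exponentials

variable {C : Type u} [Category.{v} C]

/-- The exponential of `n` by `m` in the slice over `I`, described by a universal property among
arbitrary pullback squares. -/
def HasExponential {I M N : C} (m : M ⟶ I) (n : N ⟶ I) : Prop :=
  ∃ (E Q : C) (π : E ⟶ I) (q₁ : Q ⟶ M) (q₂ : Q ⟶ E) (ev : Q ⟶ N),
    IsPullback q₁ q₂ m π ∧ ev ≫ n = q₁ ≫ m ∧
    ∀ ⦃K R : C⦄ (k : K ⟶ I) (p₁ : R ⟶ M) (p₂ : R ⟶ K), IsPullback p₁ p₂ m k →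
      ∀ g : R ⟶ N, g ≫ n = p₁ ≫ m → ∃! h : K ⟶ E, h ≫ π = k ∧
        ∀ l : R ⟶ Q, l ≫ q₁ = p₁ → l ≫ q₂ = p₂ ≫ h → l ≫ ev = g

open MonoidalCategory in
-- Any pullback square over `m` is isomorphic to the chosen product in the slice; transported along
-- this, the universal property is that of `MonoidalClosed.curry`.
theorem LocallyCartesianClosed.hasExponential [LocallyCartesianClosed C] {I M N : C} (m : M ⟶ I)
    (n : N ⟶ I) : HasExponential m n := by
  have := LocallyCartesianClosed.hasPullbacks (C := C)
  let _ := Over.cartesianMonoidalCategory I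
  obtain ⟨hc⟩ := LocallyCartesianClosed.closed I
  let F := Over.mk m
  let G := Over.mk n
  let E := (ihom F).obj G
  let ev : F ⊗ E ⟶ G := (ihom.ev F).app G
  refine ⟨E.left, (F ⊗ E).left, E.hom, pullback.fst m E.hom, pullback.snd m E.hom, ev.left,
    IsPullback.of_hasPullback m E.hom, Over.w ev, fun K R k p₁ p₂ hR g hg => ?_⟩
  let i := hR.isoPullback
  let g' : F ⊗ Over.mk k ⟶ G := Over.homMk (i.inv ≫ g) (by
    change (i.inv ≫ g) ≫ n = pullback.fst m k ≫ m
    rw [Category.assoc, hg, ← Category.assoc, hR.isoPullback_inv_fst])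
  have key : ∀ h : Over.mk k ⟶ E, h = MonoidalClosed.curry g' ↔
      ∀ l : R ⟶ (F ⊗ E).left, l ≫ pullback.fst m E.hom = p₁ →
        l ≫ pullback.snd m E.hom = p₂ ≫ h.left → l ≫ ev.left = g := by
    intro h
    have h0 : (i.hom ≫ (F ◁ h).left) ≫ pullback.fst m E.hom = p₁ := by
      rw [Category.assoc]
      erw [Over.whiskerLeft_left_fst]
      exact hR.isoPullback_hom_fst
    have h1 : (i.hom ≫ (F ◁ h).left) ≫ pullback.snd m E.hom = p₂ ≫ h.left := by
      rw [Category.assoc]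
      erw [Over.whiskerLeft_left_snd]
      rw [← Category.assoc]
      exact congrArg (· ≫ h.left) hR.isoPullback_hom_snd
    rw [MonoidalClosed.eq_curry_iff, MonoidalClosed.uncurry_eq]
    constructor
    · intro e l hl1 hl2
      have hl : l = i.hom ≫ (F ◁ h).left :=
        pullback.hom_ext (hl1.trans h0.symm) (hl2.trans h1.symm)
      have e' : (F ◁ h).left ≫ ev.left = i.inv ≫ g := congrArg CommaMorphism.left e
      rw [hl, Category.assoc, e', i.hom_inv_id_assoc]
    · intro e
      ext
      have e' := e _ h0 h1
      rw [Category.assoc] at e'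
      change (F ◁ h).left ≫ ev.left = i.inv ≫ g
      rw [← e', i.inv_hom_id_assoc]
  refine ⟨(MonoidalClosed.curry g').left, ⟨Over.w _, (key _).1 rfl⟩, ?_⟩
  rintro h ⟨h1, h2⟩
  exact congrArg CommaMorphism.left ((key (Over.homMk h h1)).2 h2)

open MonoidalCategory in
-- The universal property says that evaluation is terminal among the arrows `F ⊗ K ⟶ G`, which gives
-- the right adjoint of `tensorLeft F`.
theorem LocallyCartesianClosed.of_hasExponential [HasPullbacks C]
    (H : ∀ {I M N : C} (m : M ⟶ I) (n : N ⟶ I), HasExponential m n) :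
    LocallyCartesianClosed C where
  hasPullbacks := inferInstance
  closed X := by
    let _ := Over.cartesianMonoidalCategory X
    have hF : ∀ F : Over X, (tensorLeft F).IsLeftAdjoint := by
      intro F
      have : ∀ G : Over X, HasTerminal (CostructuredArrow (tensorLeft F) G) := by
        intro G
        obtain ⟨E, Q, π, q₁, q₂, ev, hQ, hev, hu⟩ := H F.hom G.hom
        let i := hQ.isoPullback
        let ev' : F ⊗ Over.mk π ⟶ G := Over.homMk (i.inv ≫ ev) (by
          change (i.inv ≫ ev) ≫ G.hom = pullback.fst F.hom π ≫ F.hom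
          rw [Category.assoc, hev, ← Category.assoc, hQ.isoPullback_inv_fst])
        have key : ∀ {K : Over X} (g : F ⊗ K ⟶ G) (h : K ⟶ Over.mk π),
            (∀ l : (F ⊗ K).left ⟶ Q, l ≫ q₁ = pullback.fst F.hom K.hom →
              l ≫ q₂ = pullback.snd F.hom K.hom ≫ h.left → l ≫ ev = g.left) ↔
              F ◁ h ≫ ev' = g := by
          intro K g h
          have h0 : ((F ◁ h).left ≫ i.inv) ≫ q₁ = pullback.fst F.hom K.hom := by
            rw [Category.assoc, hQ.isoPullback_inv_fst]
            exact Over.whiskerLeft_left_fst h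
          have h1 : ((F ◁ h).left ≫ i.inv) ≫ q₂ = pullback.snd F.hom K.hom ≫ h.left := by
            rw [Category.assoc, hQ.isoPullback_inv_snd]
            exact Over.whiskerLeft_left_snd h
          constructor
          · intro e
            ext
            have e' := e _ h0 h1
            rwa [Category.assoc] at e'
          · rintro rfl l hl1 hl2
            have hl : l = (F ◁ h).left ≫ i.inv :=
              hQ.hom_ext (hl1.trans h0.symm) (hl2.trans h1.symm)
            rw [hl, Category.assoc]
            rfl
        refine IsTerminal.hasTerminal
          (X := CostructuredArrow.mk (S := tensorLeft F) (Y := Over.mk π) ev') ?_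
        have hex : ∀ A : CostructuredArrow (tensorLeft F) G, ∃! h : A.left.left ⟶ E,
            h ≫ π = A.left.hom ∧ ∀ l : (F ⊗ A.left).left ⟶ Q,
              l ≫ q₁ = pullback.fst F.hom A.left.hom →
              l ≫ q₂ = pullback.snd F.hom A.left.hom ≫ h → l ≫ ev = A.hom.left := fun A =>
          hu A.left.hom _ _ (IsPullback.of_hasPullback F.hom A.left.hom) A.hom.left (Over.w A.hom)
        choose h hh hh' using hex
        refine IsTerminal.ofUniqueHom (fun A => CostructuredArrow.homMk
          (Over.homMk (h A) (hh A).1) ((key _ _).1 (hh A).2)) fun A f => ?_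
        ext
        exact hh' A _ ⟨Over.w f.left, (key _ _).2 (CostructuredArrow.w f)⟩
      exact isLeftAdjoint_of_costructuredArrowTerminals _
    exact ⟨⟨fun F => ⟨_, Adjunction.ofIsLeftAdjoint (tensorLeft F)⟩⟩⟩

end Exponentials

/-! ### Exponentials of assemblies -/

namespace Assembly

variable {C : Type u} [Category.{v} C] [HeytingCategory C] {P : OPCAPair C}

/-- A point of `E₀` is a base point of `I` with a function between the fibres over it. It is
realized by a pair of a realizer of the base point and a tracker of the function; restricting to the
support keeps the functions that have trackers. -/
theorem hasExponential [LocallyCartesianClosed C] {I M N : Assembly P} (m : M ⟶ I) (n : N ⟶ I) :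
    HasExponential m n := by
  obtain ⟨E₀, Q₀, π₀, r, q, ev₀, hQ₀, hev₀, hu⟩ :=
    LocallyCartesianClosed.hasExponential m.hom n.hom
  let Y : RPred P E₀ :=
    I.pred.pull π₀ ⊓ RPred.allImp q (M.pred.pull r).rel (N.pred.pull ev₀)
  obtain ⟨E, j, hj, hE, hE', hlift⟩ := exists_support Y
  let π : E ⟶ I := homMk (j ≫ π₀)
    (hE.trans ((RPred.pull_mono j (RPred.inf_le_left _ _)).trans (RPred.le_pull_comp _ _ _)))
  obtain ⟨Q, q₁, q₂, hQ, hQ', hQ''⟩ := exists_isPullback m π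
  let t : Q.X ⟶ Q₀ := hQ₀.lift q₁.hom (q₂.hom ≫ j) (by
    rw [hQ'.w, Category.assoc]; rfl)
  have ht₁ : t ≫ r = q₁.hom := hQ₀.lift_fst _ _ _
  have ht₂ : t ≫ q = q₂.hom ≫ j := hQ₀.lift_snd _ _ _
  have hev : Q.pred ≤ N.pred.pull (t ≫ ev₀) := by
    have h1 : (RPred.allImp q (M.pred.pull r).rel (N.pred.pull ev₀)).pull q ⊓ M.pred.pull r ≤
        N.pred.pull ev₀ := RPred.inf_le_of_le_allImp le_rfl
    refine le_trans ?_ ((RPred.pull_mono t h1).trans (RPred.le_pull_comp _ _ _))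
    refine le_trans (RPred.le_inf ?_ ?_) (RPred.le_pull_inf _ _ _)
    · refine le_trans ?_ (RPred.pull_comp_le _ _ _)
      rw [ht₂]
      refine le_trans ?_ (RPred.pull_mono _ (RPred.inf_le_right (I.pred.pull π₀) _))
      exact (pred_le_pull q₂).trans ((RPred.pull_mono _ hE).trans (RPred.le_pull_comp _ _ _))
    · refine le_trans ?_ (RPred.pull_comp_le _ _ _)
      rw [ht₁]
      exact pred_le_pull q₁
  refine ⟨E, Q, π, q₁, q₂, homMk (t ≫ ev₀) hev, hQ, hom_ext ?_, ?_⟩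
  · change (t ≫ ev₀) ≫ n.hom = q₁.hom ≫ m.hom
    rw [Category.assoc, hev₀, ← Category.assoc, ht₁]
  intro K R k p₁ p₂ hR g hg
  obtain ⟨hR', hR''⟩ := isPullback_iff.1 hR
  obtain ⟨h₀, ⟨hh₁, hh₂⟩, huniq⟩ := hu k.hom p₁.hom p₂.hom hR' g.hom (congrArg Hom.hom hg)
  let s : R.X ⟶ Q₀ := hQ₀.lift p₁.hom (p₂.hom ≫ h₀) (by rw [hR'.w, Category.assoc, hh₁])
  have hs₁ : s ≫ r = p₁.hom := hQ₀.lift_fst _ _ _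
  have hs₂ : s ≫ q = p₂.hom ≫ h₀ := hQ₀.lift_snd _ _ _
  have hs : s ≫ ev₀ = g.hom := hh₂ s hs₁ hs₂
  -- By pasting, `R` is the pullback of `Q₀` along `h₀`, so `allImp` can be reindexed along `h₀`.
  have hsq : IsPullback s p₂.hom q h₀ := by
    refine IsPullback.of_right ?_ hs₂ hQ₀
    rwa [hs₁, hh₁]
  have hY : K.pred ≤ Y.pull h₀ := by
    refine le_trans (RPred.le_inf ?_ ?_) (RPred.le_pull_inf _ _ _)
    · refine le_trans ?_ (RPred.pull_comp_le _ _ _)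
      rw [hh₁]
      exact pred_le_pull k
    · refine le_trans (RPred.le_allImp ?_) (RPred.le_pull_allImp hsq _ _)
      have h1 : R.pred ≤ (N.pred.pull ev₀).pull s := by
        refine le_trans ?_ (RPred.pull_comp_le _ _ _)
        rw [hs]
        exact pred_le_pull g
      refine le_trans (le_trans (RPred.le_inf ?_ (RPred.inf_le_left _ _)) hR'') h1
      refine (RPred.inf_le_right _ _).trans ((RPred.le_pull_comp _ _ _).trans ?_)
      rw [hs₁]
  -- Every point of `K` has a realizer, and `hY` turns it into one for its image; so the transpose
  -- lands in the support.
  have hfac : Y.supp.Factors h₀ := by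
    have := Subobject.factors_of_le _ (RPred.supp_mono hY) (K.factors_supp_pred (𝟙 K.X))
    rwa [RPred.factors_supp_pull, Category.id_comp] at this
  obtain ⟨h₁, hh⟩ := hlift h₀ hfac
  have hle : K.pred ≤ E.pred.pull h₁ := by
    refine le_trans ?_ ((RPred.pull_comp_le _ _ _).trans (RPred.pull_mono _ hE'))
    rw [hh]
    exact hY
  -- Uniqueness reduces to the base: every arrow `l` to `Q₀` that has to be tested there underlies a
  -- morphism `l'` into `Q`, followed by `t`.
  have key : ∀ (h : K ⟶ E), (∀ l : R ⟶ Q, l ≫ q₁ = p₁ → l ≫ q₂ = p₂ ≫ h →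
      l ≫ homMk (t ≫ ev₀) hev = g) → h ≫ π = k → h.hom ≫ j = h₀ := by
    intro h H H'
    have H₁ : h.hom ≫ j ≫ π₀ = k.hom := congrArg Hom.hom H'
    refine huniq _ ⟨by rw [Category.assoc]; exact H₁, fun l hl₁ hl₂ => ?_⟩
    let l' : R ⟶ Q := hQ.lift p₁ (p₂ ≫ h) (by rw [hR.w, Category.assoc, H'])
    have hl' : l'.hom ≫ t = l := hQ₀.hom_ext
      (by rw [Category.assoc, ht₁, hl₁]; exact congrArg Hom.hom (hQ.lift_fst _ _ _))
      (by
        rw [Category.assoc, ht₂, hl₂, ← Category.assoc, ← Category.assoc]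
        exact congrArg (· ≫ j) (congrArg Hom.hom (hQ.lift_snd _ _ _)))
    rw [← hl', Category.assoc]
    exact congrArg Hom.hom (H l' (hQ.lift_fst _ _ _) (hQ.lift_snd _ _ _))
  refine ⟨homMk h₁ hle, ⟨hom_ext ?_, fun l hl₁ hl₂ => hom_ext ?_⟩, ?_⟩
  · change h₁ ≫ j ≫ π₀ = k.hom
    rw [← Category.assoc, hh, hh₁]
  · change l.hom ≫ t ≫ ev₀ = g.hom
    rw [← Category.assoc]
    refine hh₂ _ ?_ ?_
    · rw [Category.assoc, ht₁]
      exact congrArg Hom.hom hl₁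
    · have : l.hom ≫ q₂.hom = p₂.hom ≫ h₁ := congrArg Hom.hom hl₂
      rw [Category.assoc, ht₂, ← Category.assoc, this, Category.assoc, hh]
  · rintro h ⟨H', H⟩
    refine hom_ext ((cancel_mono j).1 ?_)
    rw [key h H H']
    exact hh.symm

end Assembly

theorem mainTheorem5 {C : Type u} [Category.{v} C] [HeytingCategory C] [LocallyCartesianClosed C]
    (P : OPCAPair C) : HeytingCategory (Assembly P) ∧ LocallyCartesianClosed (Assembly P) :=
  ⟨inferInstance, LocallyCartesianClosed.of_hasExponential fun m n => Assembly.hasExponential m n⟩
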